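/- For $0\le x<1$ let $K(x)=\frac{\pi}{2}\,{}_2F_1\left(\frac12,\frac12;1;x^2\right)$ be the complete elliptic integral of the first kind with modulus $x$. Let $r>0$ and $q=e^{-\pi\sqrt r}$. There is exactly one $k_r\in(0,1)$ with $K\left(\sqrt{1-k_r^2}\right)/K(k_r)=\sqrt r$; write $K=K(k_r)$ and $K'=K\left(\sqrt{1-k_r^2}\right)$. The series $$\mathrm{cd}_1(q,u)=\frac{2\pi}{Kk_r}\sum_{n=0}^{\infty}\frac{(-1)^n q^{n+1/2}\cos\left((2n+3)\frac{\pi}{2K}u\right)}{1-q^{2n+1}}$$ converges absolutely for every complex $u$ with $|\mathrm{Im}\,u|<K'$, and the function $u\mapsto\mathrm{cd}_1(q,u)$ has an analytic continuation from this strip to a connected open set that contains the strip and the point $iK'$. The value at $iK'$ of every such continuation, denoted $\mathrm{cd}_1(q,iK')$, is $$\mathrm{cd}_1(q,iK')=\frac{1}{q k_r}-\frac{\sinh(\pi\sqrt r)}{k_r}\left(1-\frac{\pi}{2K}\right).$$ -/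

import Mathlib

/-- The complete elliptic integral of the first kind `K(x) = (π/2) ₂F₁(1/2, 1/2; 1; x²)`,
as a function of the modulus `x`. -/
noncomputable def ellipticK (x : ℝ) : ℝ :=
  Real.pi / 2 * ordinaryHypergeometric (1 / 2 : ℝ) (1 / 2 : ℝ) (1 : ℝ) (x ^ 2)

/-- The complementary integral `K'(x) = K(√(1 - x²))`. -/
noncomputable def ellipticK' (x : ℝ) : ℝ := ellipticK (Real.sqrt (1 - x ^ 2))

/-- `k` is the elliptic singular modulus `k_r`: `0 < k < 1` and `K'(k) / K(k) = √r`. -/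
def IsSingularModulus (r k : ℝ) : Prop :=
  0 < k ∧ k < 1 ∧ ellipticK' k / ellipticK k = Real.sqrt r

/-- The `n`-th term of the series defining `cd₁(q, u)` (without the factor `2π / (K k)`), for the
nome `q` and modulus `k`. -/
noncomputable def cd1Term (q k : ℝ) (u : ℂ) (n : ℕ) : ℂ :=
  (-1) ^ n * ((q ^ ((n : ℝ) + 1 / 2) : ℝ) : ℂ) *
      Complex.cos ((2 * (n : ℂ) + 3) * ((Real.pi : ℂ) / (2 * (ellipticK k : ℂ))) * u) /
    (1 - (q : ℂ) ^ (2 * n + 1))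

/-- `cd₁(q, u) = (2π / (K k)) ∑ₙ (-1)ⁿ q^(n+1/2) cos((2n+3)πu/(2K)) / (1 - q^(2n+1))`,
as a function of `u`, wherever the series converges. -/
noncomputable def cd1 (q k : ℝ) (u : ℂ) : ℂ :=
  (2 * (Real.pi : ℂ)) / ((ellipticK k : ℂ) * (k : ℂ)) * ∑' n : ℕ, cd1Term q k u n

/-- The strip `|Im u| < K'(k)`, in which the series of `cd₁` converges when `k = k_r` and
`q = exp (-π√r)`. -/
def cd1Strip (k : ℝ) : Set ℂ := {u : ℂ | |u.im| < ellipticK' k}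

/-- `F` on the domain (connected open set) `U` is an analytic continuation of `f` from `S`. -/
def IsAnalyticContinuation (f : ℂ → ℂ) (S : Set ℂ) (F : ℂ → ℂ) (U : Set ℂ) : Prop :=
  IsOpen U ∧ IsConnected U ∧ S ⊆ U ∧ AnalyticOnNhd ℂ F U ∧ Set.EqOn F f S

/-! Put `s = √r`, `ρ = q^(1/2)` and `w = exp(iπu/(2K))`. Writing the cosine in powers of `w`,
expanding `1/(1 - q^(2n+1))` geometrically and exchanging the two sums turns the series into `(w²
S(w) + w⁻² S(w⁻¹))/2`, where `S(w) = ∑ x/(1 + x²)` over `x = ρ^(2m+1) w` (`hasSum_oddPowerSum`).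
Since `S` is meromorphic on the whole plane, this expression continues `cd₁`. At `u = iK'` one has
`w = ρ`, the `x` are powers of `q`, and `S(ρ)`, `S(ρ⁻¹)` equal `(L - 1)/4`, `(L + 1)/4` with `L = ∑
sech(πsn)` over `ℤ` (`oddPowerSum_values`). The formula thus reduces to `L = 2K/π`.

Both sides equal `θ₃(s)²`, for the same reason: divided by `θ₃(s)²`, each is invariant under `s ↦
2s` and tends to `1` as `s → ∞`. For `2K/π` the invariance is Landen's transformation
(`ellipticF_landen`), for `L` a convolution identity (`sechSum_div_two_mul`). Poisson summation
gives `K'/K = s` for the modulus `θ₂²/θ₃²`, and monotonicity of `K'/K` makes it the only one.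

An arbitrary continuation is compared with the meromorphic one by
`AnalyticOnNhd.eq_of_meromorphicOn`. -/

open Finset Filter Topology MeasureTheory

/-! ### The complete elliptic integral as a power series. -/

/-- The Taylor coefficients of `(1 - z) ^ (-1/2)`. -/
noncomputable def invSqrtCoeff (n : ℕ) : ℝ := ∏ i ∈ range n, (2 * (i : ℝ) + 1) / (2 * i + 2)

lemma invSqrtCoeff_pos (n : ℕ) : 0 < invSqrtCoeff n :=
  Finset.prod_pos fun i _ => by positivity

lemma invSqrtCoeff_le_one (n : ℕ) : invSqrtCoeff n ≤ 1 :=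
  Finset.prod_le_one (fun i _ => by positivity) fun i _ => by
    rw [div_le_one (by positivity)]; linarith

lemma invSqrtCoeff_zero : invSqrtCoeff 0 = 1 := by simp [invSqrtCoeff]

/-- Used over `ℝ` for the hypergeometric coefficients and over `ℂ` for the binomial ones. The
product has the shape of Wallis' formula for the integral of `sin^(2n)`. -/
lemma ascPochhammer_eval_half {F : Type*} [Field F] [CharZero F] (n : ℕ) :
    (ascPochhammer F n).eval (1 / 2) =
      n.factorial * ∏ i ∈ range n, (2 * (i : F) + 1) / (2 * i + 2) := by
  induction n with
  | zero => simp
  | succ n ih =>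
    have h : (2 * (n : F) + 2) ≠ 0 := by exact_mod_cast (by omega : 2 * n + 2 ≠ 0)
    rw [ascPochhammer_succ_eval, ih, prod_range_succ, Nat.factorial_succ]
    push_cast
    field_simp
    ring

/-- The normalised complete elliptic integral `₂F₁(1/2, 1/2; 1; y)`. -/
noncomputable def ellipticF (y : ℝ) : ℝ := ∑' n : ℕ, invSqrtCoeff n ^ 2 * y ^ n

lemma ellipticK_eq (x : ℝ) : ellipticK x = Real.pi / 2 * ellipticF (x ^ 2) := by
  rw [ellipticK, ordinaryHypergeometric_eq_tsum, ellipticF]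
  congr 1
  refine tsum_congr fun n => ?_
  have h : (n.factorial : ℝ) ≠ 0 := by exact_mod_cast n.factorial_ne_zero
  rw [ascPochhammer_eval_half, ascPochhammer_eval_one, invSqrtCoeff, smul_eq_mul]
  field_simp

lemma summable_ellipticF {y : ℝ} (h0 : 0 ≤ y) (h1 : y < 1) :
    Summable fun n : ℕ => invSqrtCoeff n ^ 2 * y ^ n := by
  refine Summable.of_nonneg_of_le (fun n => by positivity) (fun n => ?_)
    (summable_geometric_of_lt_one h0 h1)
  exact mul_le_of_le_one_left (by positivity)
    (pow_le_one₀ (invSqrtCoeff_pos n).le (invSqrtCoeff_le_one n))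

lemma one_le_ellipticF {y : ℝ} (h0 : 0 ≤ y) (h1 : y < 1) : 1 ≤ ellipticF y := by
  have := (summable_ellipticF h0 h1).le_tsum 0 fun n _ => by positivity
  simpa [invSqrtCoeff_zero, ellipticF] using this

lemma ellipticF_le {y : ℝ} (h0 : 0 ≤ y) (h1 : y < 1) : ellipticF y ≤ (1 - y)⁻¹ := by
  rw [← tsum_geometric_of_lt_one h0 h1]
  refine (summable_ellipticF h0 h1).tsum_le_tsum (fun n => ?_)
    (summable_geometric_of_lt_one h0 h1)
  exact mul_le_of_le_one_left (by positivity)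
    (pow_le_one₀ (invSqrtCoeff_pos n).le (invSqrtCoeff_le_one n))

lemma ellipticF_lt {x y : ℝ} (h0 : 0 ≤ x) (hxy : x < y) (h1 : y < 1) :
    ellipticF x < ellipticF y := by
  refine Summable.tsum_lt_tsum (i := 1) (fun n => ?_) ?_
    (summable_ellipticF h0 (hxy.trans h1)) (summable_ellipticF (h0.trans hxy.le) h1)
  · gcongr
  · simpa using mul_lt_mul_of_pos_left hxy (pow_pos (invSqrtCoeff_pos 1) 2)

lemma ellipticK_pos {x : ℝ} (h0 : 0 ≤ x) (h1 : x < 1) : 0 < ellipticK x := by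
  rw [ellipticK_eq]
  have := one_le_ellipticF (sq_nonneg x) (pow_lt_one₀ h0 h1 two_ne_zero)
  have := Real.pi_pos
  positivity

lemma ellipticK_lt {x y : ℝ} (h0 : 0 ≤ x) (hxy : x < y) (h1 : y < 1) :
    ellipticK x < ellipticK y := by
  rw [ellipticK_eq, ellipticK_eq]
  have := ellipticF_lt (sq_nonneg x) (pow_lt_pow_left₀ hxy h0 two_ne_zero)
    (pow_lt_one₀ (h0.trans hxy.le) h1 two_ne_zero)
  have := Real.pi_pos
  gcongr

lemma tendsto_ellipticF {f : ℕ → ℝ} (h0 : ∀ n, 0 ≤ f n) (h1 : ∀ n, f n < 1)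
    (hf : Tendsto f atTop (𝓝 0)) : Tendsto (fun n => ellipticF (f n)) atTop (𝓝 1) := by
  have h : Tendsto (fun n => (1 - f n)⁻¹) atTop (𝓝 1) := by
    simpa using (tendsto_const_nhds.sub hf).inv₀ (by norm_num : (1 : ℝ) - 0 ≠ 0)
  exact tendsto_of_tendsto_of_tendsto_of_le_of_le tendsto_const_nhds h
    (fun n => one_le_ellipticF (h0 n) (h1 n)) (fun n => ellipticF_le (h0 n) (h1 n))

/-! ### Landen's transformation by Parseval. -/

lemma norm_invSqrtCoeff_mul_pow_le (z : ℂ) (n : ℕ) : ‖(invSqrtCoeff n : ℂ) * z ^ n‖ ≤ ‖z‖ ^ n := by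
  rw [norm_mul, norm_pow, Complex.norm_real, Real.norm_of_nonneg (invSqrtCoeff_pos n).le]
  exact mul_le_of_le_one_left (by positivity) (invSqrtCoeff_le_one n)

lemma summable_norm_invSqrtCoeff {z : ℂ} (hz : ‖z‖ < 1) :
    Summable fun n : ℕ => ‖(invSqrtCoeff n : ℂ) * z ^ n‖ :=
  Summable.of_nonneg_of_le (fun _ => norm_nonneg _) (norm_invSqrtCoeff_mul_pow_le z)
    (summable_geometric_of_lt_one (norm_nonneg _) hz)

/-- The sum of the binomial series of `(1 - z) ^ (-1/2)`. -/
noncomputable def invSqrtSeries (z : ℂ) : ℂ := ∑' n : ℕ, (invSqrtCoeff n : ℂ) * z ^ n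

/-- Squaring avoids any choice of branch; where a root is needed later, positivity selects it. -/
lemma invSqrtSeries_sq {z : ℂ} (hz : ‖z‖ < 1) : invSqrtSeries z ^ 2 = (1 - z)⁻¹ := by
  have h := (Complex.one_div_one_sub_cpow_hasFPowerSeriesOnBall_zero (1 / 2)).hasSum
    (y := z) (by simpa [← ofReal_norm] using hz)
  have hc (n : ℕ) : Ring.choose ((1 / 2 : ℂ) + n - 1) n = (invSqrtCoeff n : ℂ) := by
    have h1 := Ring.factorial_nsmul_multichoose_eq_ascPochhammer (1 / 2 : ℂ) n
    rw [Polynomial.ascPochhammer_smeval_eq_eval, ascPochhammer_eval_half, Ring.multichoose_eq,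
      nsmul_eq_mul] at h1
    have h2 := mul_left_cancel₀ (by exact_mod_cast n.factorial_ne_zero) h1
    rw [h2, invSqrtCoeff]
    push_cast
    rfl
  have h' : invSqrtSeries z = 1 / (1 - z) ^ (1 / 2 : ℂ) := by
    rw [invSqrtSeries, ← zero_add z, ← h.tsum_eq]
    refine tsum_congr fun n => ?_
    simp only [FormalMultilinearSeries.ofScalars_apply_eq, hc, smul_eq_mul, zero_add]
  rw [h', div_pow, one_pow, ← Complex.cpow_nat_mul, one_div]
  norm_num

lemma invSqrtSeries_ofReal (x : ℝ) :
    invSqrtSeries x = ((∑' n : ℕ, invSqrtCoeff n * x ^ n : ℝ) : ℂ) := by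
  rw [invSqrtSeries]; push_cast; rfl

/-- Integrated termwise: by Wallis, each `sin^(2n)` contributes `π` times a second factor
`invSqrtCoeff n`. -/
lemma integral_tsum_sin_sq {y : ℝ} (h0 : 0 ≤ y) (h1 : y < 1) :
    ∫ φ in (0 : ℝ)..Real.pi, ∑' n : ℕ, invSqrtCoeff n * (y * Real.sin φ ^ 2) ^ n =
      Real.pi * ellipticF y := by
  have hle (n : ℕ) (φ : ℝ) : ‖invSqrtCoeff n * (y * Real.sin φ ^ 2) ^ n‖ ≤ y ^ n := by
    have hs : 0 ≤ y * Real.sin φ ^ 2 := by positivity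
    have hs' : y * Real.sin φ ^ 2 ≤ y := mul_le_of_le_one_right h0 (Real.sin_sq_le_one φ)
    rw [Real.norm_of_nonneg (mul_nonneg (invSqrtCoeff_pos n).le (pow_nonneg hs n))]
    exact (mul_le_of_le_one_left (by positivity) (invSqrtCoeff_le_one n)).trans (by gcongr)
  have h := intervalIntegral.hasSum_integral_of_dominated_convergence
    (μ := volume) (a := 0) (b := Real.pi) (F := fun n φ => invSqrtCoeff n * (y * Real.sin φ ^ 2) ^ n)
    (f := fun φ => ∑' n : ℕ, invSqrtCoeff n * (y * Real.sin φ ^ 2) ^ n) (fun n _ => y ^ n)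
    (fun n => by fun_prop) (fun n => ae_of_all _ fun φ _ => hle n φ)
    (ae_of_all _ fun _ _ => summable_geometric_of_lt_one h0 h1) (by simp)
    (ae_of_all _ fun φ _ => (Summable.of_norm_bounded (summable_geometric_of_lt_one h0 h1)
      fun n => hle n φ).hasSum)
  rw [← h.tsum_eq, ellipticF, ← tsum_mul_left]
  refine tsum_congr fun n => ?_
  have (φ : ℝ) : invSqrtCoeff n * (y * Real.sin φ ^ 2) ^ n =
      (invSqrtCoeff n * y ^ n) * Real.sin φ ^ (2 * n) := by rw [mul_pow, ← pow_mul]; ring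
  simp_rw [this]
  rw [intervalIntegral.integral_const_mul, integral_sin_pow_even, ← invSqrtCoeff]
  ring

lemma integral_exp_two_mul_I (k : ℤ) :
    ∫ φ in (0 : ℝ)..Real.pi, Complex.exp (2 * k * Complex.I * φ) =
      if k = 0 then (Real.pi : ℂ) else 0 := by
  split_ifs with h
  · simp [h]
  · have hk : (2 * k * Complex.I : ℂ) ≠ 0 := by simp [h]
    rw [integral_exp_mul_complex hk]
    have : (2 * k * Complex.I * Real.pi : ℂ) = k * (2 * Real.pi * Complex.I) := by ring
    rw [this, Complex.exp_int_mul_two_pi_mul_I]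
    simp

/-- Parseval: the functions `exp(2ikφ)` are orthogonal on `[0, π]`, so only the diagonal of the
double series survives. -/
lemma integral_norm_sq_invSqrtSeries {t : ℝ} (h0 : 0 ≤ t) (h1 : t < 1) :
    ∫ φ in (0 : ℝ)..Real.pi, ‖invSqrtSeries (-t * Complex.exp (2 * Complex.I * φ))‖ ^ 2 =
      Real.pi * ellipticF (t ^ 2) := by
  set z : ℝ → ℂ := fun φ => -t * Complex.exp (2 * Complex.I * φ) with hz
  have hnorm (φ : ℝ) : ‖z φ‖ = t := by
    have : (2 * Complex.I * φ : ℂ) = ((2 * φ : ℝ) : ℂ) * Complex.I := by push_cast; ring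
    rw [hz, norm_mul, this, Complex.norm_exp_ofReal_mul_I]
    simp [abs_of_nonneg h0]
  have hconj (φ : ℝ) : (starRingEnd ℂ) (z φ) = -t * Complex.exp (-(2 * Complex.I * φ)) := by
    simp [hz, ← Complex.exp_conj, Complex.conj_ofNat]
  set F : ℕ × ℕ → ℝ → ℂ := fun p φ =>
    ((invSqrtCoeff p.1 : ℂ) * z φ ^ p.1) * ((invSqrtCoeff p.2 : ℂ) * (starRingEnd ℂ) (z φ) ^ p.2)
  have hle (p : ℕ × ℕ) (φ : ℝ) : ‖F p φ‖ ≤ t ^ p.1 * t ^ p.2 := by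
    rw [norm_mul]
    refine mul_le_mul ((norm_invSqrtCoeff_mul_pow_le _ _).trans_eq ?_)
      ((norm_invSqrtCoeff_mul_pow_le _ _).trans_eq ?_) (norm_nonneg _) (by positivity)
    · rw [hnorm]
    · rw [RCLike.norm_conj, hnorm]
  have hgeo := summable_geometric_of_lt_one h0 h1
  have hsum : Summable fun p : ℕ × ℕ => t ^ p.1 * t ^ p.2 :=
    hgeo.mul_of_nonneg hgeo (fun _ => by positivity) (fun _ => by positivity)
  have hval (φ : ℝ) : HasSum (fun p => F p φ) ((‖invSqrtSeries (z φ)‖ ^ 2 : ℝ) : ℂ) := by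
    have hlt : ‖z φ‖ < 1 := by rw [hnorm]; exact h1
    have hlt' : ‖(starRingEnd ℂ) (z φ)‖ < 1 := by rw [RCLike.norm_conj]; exact hlt
    have h := tsum_mul_tsum_of_summable_norm (summable_norm_invSqrtCoeff hlt)
      (summable_norm_invSqrtCoeff hlt')
    have hc : ∑' n : ℕ, (invSqrtCoeff n : ℂ) * (starRingEnd ℂ) (z φ) ^ n =
        (starRingEnd ℂ) (invSqrtSeries (z φ)) := by
      rw [invSqrtSeries, Complex.conj_tsum]
      simp
    rw [hc, ← invSqrtSeries, Complex.mul_conj, Complex.normSq_eq_norm_sq] at h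
    rw [h]
    exact (Summable.of_norm_bounded hsum fun p => hle p φ).hasSum
  have h := intervalIntegral.hasSum_integral_of_dominated_convergence
    (μ := volume) (a := 0) (b := Real.pi) (F := F)
    (f := fun φ => ((‖invSqrtSeries (z φ)‖ ^ 2 : ℝ) : ℂ)) (fun p _ => t ^ p.1 * t ^ p.2)
    (fun p => by
      have : Continuous z := by fun_prop
      have : Continuous (F p) := by
        have h2 : Continuous fun φ => (starRingEnd ℂ) (z φ) := Complex.continuous_conj.comp this
        fun_prop
      exact this.aestronglyMeasurable)
    (fun p => ae_of_all _ fun φ _ => hle p φ)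
    (ae_of_all _ fun _ _ => hsum) (by simp)
    (ae_of_all _ fun φ _ => hval φ)
  have hint (p : ℕ × ℕ) : ∫ φ in (0 : ℝ)..Real.pi, F p φ =
      if p.1 = p.2 then ((Real.pi * (invSqrtCoeff p.1 ^ 2 * (t ^ 2) ^ p.1) : ℝ) : ℂ) else 0 := by
    have hF (φ : ℝ) : F p φ = (invSqrtCoeff p.1 * invSqrtCoeff p.2 * (-t) ^ (p.1 + p.2)) *
        Complex.exp (2 * ((p.1 - p.2 : ℤ) : ℂ) * Complex.I * φ) := by
      have he : (2 * ((p.1 - p.2 : ℤ) : ℂ) * Complex.I * φ : ℂ) =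
        p.1 * (2 * Complex.I * φ) + p.2 * (-(2 * Complex.I * φ)) := by push_cast; ring
      rw [he, Complex.exp_add, Complex.exp_nat_mul, Complex.exp_nat_mul]
      simp only [F]
      rw [hconj, hz]
      simp only [mul_pow]
      ring
    simp_rw [hF]
    rw [intervalIntegral.integral_const_mul, integral_exp_two_mul_I]
    by_cases hp : p.1 = p.2
    · rw [if_pos (by omega), if_pos hp, hp, ← two_mul, pow_mul, neg_sq]
      push_cast
      ring
    · rw [if_neg (by omega), if_neg hp, mul_zero]
  have hinj : Function.Injective fun n : ℕ => (n, n) := fun a b h => (Prod.mk.inj h).1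
  simp_rw [hint] at h
  rw [← hinj.hasSum_iff (fun p hp => if_neg fun hpp => hp ⟨p.1, by ext <;> simp [hpp]⟩)] at h
  have h2 := h.tsum_eq
  simp only [Function.comp_def, if_true] at h2
  rw [← Complex.ofReal_tsum, intervalIntegral.integral_ofReal, Complex.ofReal_inj] at h2
  rw [← h2, tsum_mul_left, ellipticF]

/-- **Landen's transformation** of the complete elliptic integral. -/
lemma ellipticF_landen {t : ℝ} (h0 : 0 ≤ t) (h1 : t < 1) :
    ellipticF (4 * t / (1 + t) ^ 2) = (1 + t) * ellipticF (t ^ 2) := by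
  have hy0 : 0 ≤ 4 * t / (1 + t) ^ 2 := by positivity
  have hy1 : 4 * t / (1 + t) ^ 2 < 1 := by
    rw [div_lt_one (by positivity)]
    nlinarith [sq_pos_of_pos (sub_pos.2 h1)]
  have hpi := Real.pi_pos
  refine mul_left_cancel₀ hpi.ne' ?_
  rw [mul_left_comm, ← integral_tsum_sin_sq hy0 hy1, ← integral_norm_sq_invSqrtSeries h0 h1,
    ← intervalIntegral.integral_const_mul]
  -- The integrands already agree pointwise, because `|1 + t e^(2iφ)|² = (1 + t)² - 4t sin² φ`.
  refine intervalIntegral.integral_congr fun φ _ => ?_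
  set x : ℝ := 4 * t / (1 + t) ^ 2 * Real.sin φ ^ 2 with hx
  have hx0 : 0 ≤ x := by positivity
  have hx1 : x < 1 := (mul_le_of_le_one_right hy0 (Real.sin_sq_le_one φ)).trans_lt hy1
  set z : ℂ := -t * Complex.exp (2 * Complex.I * φ) with hz
  have hexp : Complex.exp (2 * Complex.I * φ) =
      ((Real.cos (2 * φ) : ℝ) : ℂ) + ((Real.sin (2 * φ) : ℝ) : ℂ) * Complex.I := by
    rw [show (2 * Complex.I * φ : ℂ) = ((2 * φ : ℝ) : ℂ) * Complex.I by push_cast; ring,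
      Complex.exp_mul_I, Complex.ofReal_cos, Complex.ofReal_sin]
  have hz1 : ‖z‖ < 1 := by
    rw [hz, norm_mul, show (2 * Complex.I * φ : ℂ) = ((2 * φ : ℝ) : ℂ) * Complex.I by
      push_cast; ring, Complex.norm_exp_ofReal_mul_I]
    simpa [abs_of_nonneg h0] using h1
  have hA : (∑' n : ℕ, invSqrtCoeff n * x ^ n) ^ 2 = (1 - x)⁻¹ := by
    have := invSqrtSeries_sq (z := (x : ℂ)) (by simpa [abs_of_nonneg hx0] using hx1)
    rw [invSqrtSeries_ofReal] at this
    exact_mod_cast this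
  have hB : (‖invSqrtSeries z‖ ^ 2) ^ 2 = ((1 + t) ^ 2 * (1 - x))⁻¹ := by
    rw [← norm_pow, invSqrtSeries_sq hz1, norm_inv, inv_pow, ← Complex.normSq_eq_norm_sq]
    congr 1
    rw [hz, hexp, Complex.normSq_apply]
    simp only [Complex.sub_re, Complex.sub_im, Complex.mul_re, Complex.mul_im, Complex.neg_re,
      Complex.neg_im, Complex.ofReal_re, Complex.ofReal_im, Complex.add_re, Complex.add_im,
      Complex.one_re, Complex.one_im, Complex.I_re, Complex.I_im]
    have hs : (1 + t) ^ 2 * (1 - x) = (1 + t) ^ 2 - 4 * t * Real.sin φ ^ 2 := by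
      rw [hx]; field_simp
    rw [hs, Real.cos_two_mul, Real.sin_two_mul, Real.cos_sq']
    nlinarith [Real.sin_sq_add_cos_sq φ, congrArg (fun w => 4 * t ^ 2 * Real.sin φ ^ 2 * w) (Real.cos_sq' φ)]
  have hpos : 0 ≤ ∑' n : ℕ, invSqrtCoeff n * x ^ n :=
    tsum_nonneg fun n => mul_nonneg (invSqrtCoeff_pos n).le (by positivity)
  refine (pow_left_inj₀ hpos (by positivity) two_ne_zero).1 ?_
  rw [hA, mul_pow, hB]
  have : 1 - x ≠ 0 := by linarith
  field_simp

/-! ### Theta constants: doubling, inversion, limits. -/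

/-- The theta constant `θ₃` at the nome `exp (-π s)`. -/
noncomputable def thetaThree (s : ℝ) : ℝ := ∑' n : ℤ, Real.exp (-Real.pi * s * (n : ℝ) ^ 2)

/-- The theta constant `θ₄` at the nome `exp (-π s)`. -/
noncomputable def thetaFour (s : ℝ) : ℝ :=
  ∑' n : ℤ, (-1 : ℝ) ^ n * Real.exp (-Real.pi * s * (n : ℝ) ^ 2)

/-- The theta constant `θ₂` at the nome `exp (-π s)`. -/
noncomputable def thetaTwo (s : ℝ) : ℝ :=
  ∑' n : ℤ, Real.exp (-Real.pi * s * ((n : ℝ) + 1 / 2) ^ 2)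

lemma summable_exp_neg_mul_abs_int {c : ℝ} (hc : 0 < c) :
    Summable fun n : ℤ => Real.exp (-c * |(n : ℝ)|) := by
  have h : Summable fun n : ℕ => Real.exp (-c * n) := by
    have := summable_geometric_of_lt_one (Real.exp_pos (-c)).le (by simpa using hc)
    refine this.congr fun n => ?_
    rw [← Real.exp_nat_mul, mul_comm]
  refine Summable.of_nat_of_neg ?_ ?_ <;> simpa using h

lemma abs_int_le_sq (n : ℤ) : |(n : ℝ)| ≤ (n : ℝ) ^ 2 := by
  have : |n| ≤ n ^ 2 := by
    rw [← sq_abs]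
    rcases (abs_nonneg n).eq_or_lt with h | h
    · rw [← h]; norm_num
    · nlinarith
  exact_mod_cast this

lemma summable_thetaThree {s : ℝ} (hs : 0 < s) :
    Summable fun n : ℤ => Real.exp (-Real.pi * s * (n : ℝ) ^ 2) := by
  have hc : 0 < Real.pi * s := by positivity
  refine Summable.of_nonneg_of_le (fun n => by positivity) (fun n => ?_)
    (summable_exp_neg_mul_abs_int hc)
  rw [Real.exp_le_exp]
  nlinarith [abs_int_le_sq n]

lemma abs_neg_one_zpow_mul (n : ℤ) (x : ℝ) : |(-1 : ℝ) ^ n * x| = |x| := by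
  rw [abs_mul, abs_zpow]; simp

lemma summable_thetaFour {s : ℝ} (hs : 0 < s) :
    Summable fun n : ℤ => (-1 : ℝ) ^ n * Real.exp (-Real.pi * s * (n : ℝ) ^ 2) := by
  refine Summable.of_norm_bounded (summable_thetaThree hs) fun n => ?_
  rw [Real.norm_eq_abs, abs_neg_one_zpow_mul, abs_of_pos (Real.exp_pos _)]

lemma summable_thetaTwo {s : ℝ} (hs : 0 < s) :
    Summable fun n : ℤ => Real.exp (-Real.pi * s * ((n : ℝ) + 1 / 2) ^ 2) := by
  have hc : 0 < Real.pi * s := by positivity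
  refine Summable.of_nonneg_of_le (fun n => by positivity) (fun n => ?_)
    ((summable_exp_neg_mul_abs_int hc).mul_left (Real.exp (Real.pi * s)))
  rw [← Real.exp_add, Real.exp_le_exp]
  have h : |(n : ℝ)| - 1 ≤ ((n : ℝ) + 1 / 2) ^ 2 := by
    rcases abs_cases (n : ℝ) with ⟨h, _⟩ | ⟨h, _⟩ <;> rw [h] <;> nlinarith [abs_int_le_sq n,
      sq_nonneg ((n : ℝ) + 1)]
  nlinarith

lemma thetaThree_pos {s : ℝ} (hs : 0 < s) : 0 < thetaThree s :=
  (summable_thetaThree hs).tsum_pos (fun _ => (Real.exp_pos _).le) 0 (Real.exp_pos _)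

lemma thetaTwo_pos {s : ℝ} (hs : 0 < s) : 0 < thetaTwo s :=
  (summable_thetaTwo hs).tsum_pos (fun _ => (Real.exp_pos _).le) 0 (Real.exp_pos _)

/-- Split a sum over `ℤ × ℤ` according to the parity of the sum of the coordinates. -/
lemma tsum_int_prod_parity {f : ℤ × ℤ → ℝ} (hf : Summable f) :
    ∑' p, f p = ∑' p : ℤ × ℤ, f (p.1 + p.2, p.1 - p.2) +
      ∑' p : ℤ × ℤ, f (p.1 + p.2 + 1, p.1 - p.2) := by
  let g : (ℤ × ℤ) ⊕ (ℤ × ℤ) → ℤ × ℤ :=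
    Sum.elim (fun p => (p.1 + p.2, p.1 - p.2)) (fun p => (p.1 + p.2 + 1, p.1 - p.2))
  have hg : Function.Bijective g := by
    constructor
    · rintro (⟨a, b⟩ | ⟨a, b⟩) (⟨c, d⟩ | ⟨c, d⟩) h <;>
        simp only [g, Sum.elim_inl, Sum.elim_inr, Prod.mk.injEq] at h
      · congr 2 <;> omega
      · omega
      · omega
      · congr 2 <;> omega
    · rintro ⟨m, n⟩
      rcases Int.even_or_odd' (m + n) with ⟨k, h | h⟩
      · exact ⟨Sum.inl (k, m - k), by simp only [g, Sum.elim_inl, Prod.mk.injEq]; omega⟩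
      · exact ⟨Sum.inr (k, m - k - 1), by simp only [g, Sum.elim_inr, Prod.mk.injEq]; omega⟩
  let e := Equiv.ofBijective g hg
  have hs : Summable (f ∘ e) := e.summable_iff.2 hf
  rw [← e.tsum_eq f]
  exact Summable.tsum_sum (f := f ∘ e) (hs.comp_injective Sum.inl_injective)
    (hs.comp_injective Sum.inr_injective)

lemma tsum_mul_tsum_int {f g : ℤ → ℝ} (hf : Summable f) (hg : Summable g) :
    (∑' n, f n) * ∑' n, g n = ∑' p : ℤ × ℤ, f p.1 * g p.2 :=
  tsum_mul_tsum_of_summable_norm hf.norm hg.norm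

lemma summable_mul_int_prod {f g : ℤ → ℝ} (hf : Summable f) (hg : Summable g) :
    Summable fun p : ℤ × ℤ => f p.1 * g p.2 :=
  summable_mul_of_summable_norm hf.norm hg.norm

lemma neg_one_zpow_add_mul_sub (a b : ℤ) : (-1 : ℝ) ^ (a + b) * (-1 : ℝ) ^ (a - b) = 1 := by
  rw [← zpow_add₀ (by norm_num), add_add_sub_cancel]
  exact Even.neg_one_zpow ⟨a, rfl⟩

/-- With `m = a + b`, `n = a - b` the form `m² + n²` is `2(a² + b²)`; the opposite-parity pairs give
the same form at half-integers. -/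
lemma thetaThree_sq {s : ℝ} (hs : 0 < s) :
    thetaThree s ^ 2 = thetaThree (2 * s) ^ 2 + thetaTwo (2 * s) ^ 2 := by
  have h2 : 0 < 2 * s := by positivity
  have h3 := summable_thetaThree hs
  simp only [sq (thetaThree _), sq (thetaTwo _)]
  simp only [thetaThree, thetaTwo]
  rw [tsum_mul_tsum_int h3 h3, tsum_int_prod_parity (summable_mul_int_prod h3 h3),
    tsum_mul_tsum_int (summable_thetaThree h2) (summable_thetaThree h2),
    tsum_mul_tsum_int (summable_thetaTwo h2) (summable_thetaTwo h2)]
  congr 1 <;> refine tsum_congr fun p => ?_ <;> rw [← Real.exp_add, ← Real.exp_add] <;>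
    congr 1 <;> push_cast <;> ring

lemma thetaFour_sq {s : ℝ} (hs : 0 < s) :
    thetaFour s ^ 2 = thetaThree (2 * s) ^ 2 - thetaTwo (2 * s) ^ 2 := by
  have h2 : 0 < 2 * s := by positivity
  have h4 := summable_thetaFour hs
  simp only [sq (thetaThree _), sq (thetaTwo _), sq (thetaFour _)]
  simp only [thetaThree, thetaTwo, thetaFour]
  rw [tsum_mul_tsum_int h4 h4, tsum_int_prod_parity (summable_mul_int_prod h4 h4),
    tsum_mul_tsum_int (summable_thetaThree h2) (summable_thetaThree h2),
    tsum_mul_tsum_int (summable_thetaTwo h2) (summable_thetaTwo h2), sub_eq_add_neg, ← tsum_neg]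
  congr 1 <;> refine tsum_congr fun p => ?_
  · rw [mul_mul_mul_comm, neg_one_zpow_add_mul_sub, one_mul, ← Real.exp_add, ← Real.exp_add]
    congr 1; push_cast; ring
  · have he : Real.exp (-Real.pi * s * ((p.1 + p.2 + 1 : ℤ) : ℝ) ^ 2) *
        Real.exp (-Real.pi * s * ((p.1 - p.2 : ℤ) : ℝ) ^ 2) =
        Real.exp (-Real.pi * (2 * s) * ((p.1 : ℝ) + 1 / 2) ^ 2) *
        Real.exp (-Real.pi * (2 * s) * ((p.2 : ℝ) + 1 / 2) ^ 2) := by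
      rw [← Real.exp_add, ← Real.exp_add]
      congr 1; push_cast; ring
    rw [zpow_add_one₀ (by norm_num), ← he]
    linear_combination (-(Real.exp (-Real.pi * s * ((p.1 + p.2 + 1 : ℤ) : ℝ) ^ 2) *
        Real.exp (-Real.pi * s * ((p.1 - p.2 : ℤ) : ℝ) ^ 2))) * neg_one_zpow_add_mul_sub p.1 p.2

lemma thetaTwo_sq {s : ℝ} (hs : 0 < s) :
    thetaTwo s ^ 2 = 2 * thetaThree (2 * s) * thetaTwo (2 * s) := by
  have h2 : 0 < 2 * s := by positivity
  have ht := summable_thetaTwo hs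
  suffices h : thetaTwo s * thetaTwo s =
      thetaThree (2 * s) * thetaTwo (2 * s) + thetaTwo (2 * s) * thetaThree (2 * s) by
    rw [sq, h]; ring
  simp only [thetaThree, thetaTwo]
  rw [tsum_mul_tsum_int ht ht, tsum_int_prod_parity (summable_mul_int_prod ht ht), add_comm,
    tsum_mul_tsum_int (summable_thetaThree h2) (summable_thetaTwo h2),
    tsum_mul_tsum_int (summable_thetaTwo h2) (summable_thetaThree h2)]
  congr 1
  -- The odd class produces `2((a + 1)² + (b + 1/2)²)`, hence the unit shift of the first index.
  · rw [← ((Equiv.addRight (1 : ℤ)).prodCongr (Equiv.refl ℤ)).tsum_eq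
      fun p : ℤ × ℤ => Real.exp (-Real.pi * (2 * s) * (p.1 : ℝ) ^ 2) *
        Real.exp (-Real.pi * (2 * s) * ((p.2 : ℝ) + 1 / 2) ^ 2)]
    refine tsum_congr fun p => ?_
    rw [← Real.exp_add, ← Real.exp_add]
    congr 1
    simp
    ring
  · refine tsum_congr fun p => ?_
    rw [← Real.exp_add, ← Real.exp_add]
    congr 1
    push_cast
    ring

lemma thetaThree_inv {s : ℝ} (hs : 0 < s) : thetaThree s⁻¹ = √s * thetaThree s := by
  have h := Real.tsum_exp_neg_mul_int_sq hs
  rw [← Real.sqrt_eq_rpow] at h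
  have h0 : √s ≠ 0 := (Real.sqrt_pos.2 hs).ne'
  rw [thetaThree, thetaThree, h]
  field_simp

lemma thetaFour_eq {s : ℝ} (hs : 0 < s) : thetaFour s = (√s)⁻¹ * thetaTwo s⁻¹ := by
  have h := Complex.tsum_exp_neg_quadratic (a := s) (by simpa using hs) (Complex.I / 2)
  -- The phase `I/2` yields `(-1)ⁿ` on one side of Poisson summation and `(n - 1/2)²` on the other;
  -- the shift makes it `(n + 1/2)²`.
  rw [← (Equiv.addRight (1 : ℤ)).tsum_eq (fun n : ℤ => Complex.exp (-Real.pi / s * _ ^ 2))] at h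
  have hl (n : ℤ) : Complex.exp (-Real.pi * s * n ^ 2 + 2 * Real.pi * (Complex.I / 2) * n) =
      (((-1 : ℝ) ^ n * Real.exp (-Real.pi * s * (n : ℝ) ^ 2) : ℝ) : ℂ) := by
    rw [Complex.exp_add, show (2 * Real.pi * (Complex.I / 2) * n : ℂ) = n * (Real.pi * Complex.I) by
      ring, Complex.exp_int_mul, Complex.exp_pi_mul_I, mul_comm]
    push_cast
    rfl
  have hr (n : ℤ) : Complex.exp (-Real.pi / s * (((Equiv.addRight (1 : ℤ) n : ℤ) : ℂ) +
      Complex.I * (Complex.I / 2)) ^ 2) =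
      ((Real.exp (-Real.pi * s⁻¹ * ((n : ℝ) + 1 / 2) ^ 2) : ℝ) : ℂ) := by
    push_cast
    congr 1
    rw [← mul_div_assoc, Complex.I_mul_I, Equiv.coe_addRight]
    push_cast
    ring
  simp_rw [hl, hr] at h
  rw [thetaFour, thetaTwo, Real.sqrt_eq_rpow]
  rw [← Complex.ofReal_inj]
  push_cast [Complex.ofReal_cpow hs.le] at h ⊢
  rw [h, one_div]

lemma thetaFour_pos {s : ℝ} (hs : 0 < s) : 0 < thetaFour s := by
  rw [thetaFour_eq hs]
  have := thetaTwo_pos (inv_pos.2 hs)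
  positivity

lemma thetaTwo_inv {s : ℝ} (hs : 0 < s) : thetaTwo s⁻¹ = √s * thetaFour s := by
  have := (Real.sqrt_pos.2 hs).ne'
  rw [thetaFour_eq hs]
  field_simp

/-- Jacobi's quartic identity for theta constants. -/
lemma thetaThree_pow_four {s : ℝ} (hs : 0 < s) :
    thetaThree s ^ 4 = thetaTwo s ^ 4 + thetaFour s ^ 4 := by
  have h3 := thetaThree_sq hs
  have h2 := thetaTwo_sq hs
  have h4 := thetaFour_sq hs
  rw [show thetaThree s ^ 4 = (thetaThree s ^ 2) ^ 2 by ring,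
    show thetaTwo s ^ 4 = (thetaTwo s ^ 2) ^ 2 by ring,
    show thetaFour s ^ 4 = (thetaFour s ^ 2) ^ 2 by ring, h3, h2, h4]
  ring

lemma tendsto_thetaThree : Tendsto thetaThree atTop (𝓝 1) := by
  have h := tendsto_tsum_of_dominated_convergence (𝓕 := atTop)
    (f := fun (s : ℝ) (n : ℤ) => Real.exp (-Real.pi * s * (n : ℝ) ^ 2))
    (g := fun n : ℤ => if n = 0 then (1 : ℝ) else 0) (summable_thetaThree one_pos)
    (fun n => by
      split_ifs with hn
      · simp [hn]
      · have : 0 < Real.pi * (n : ℝ) ^ 2 := by positivity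
        refine Real.tendsto_exp_atBot.comp ?_
        have := (tendsto_id (α := ℝ) (x := atTop)).const_mul_atTop_of_neg (neg_neg_of_pos this)
        refine this.congr fun s => ?_
        simp only [id]; ring)
    (by
      filter_upwards [eventually_ge_atTop 1] with s hs n
      rw [Real.norm_of_nonneg (Real.exp_pos _).le, Real.exp_le_exp]
      have : 0 < Real.pi := Real.pi_pos
      nlinarith [mul_nonneg this.le (mul_nonneg (sub_nonneg.2 hs) (sq_nonneg (n : ℝ)))])
  simp only [tsum_ite_eq] at h
  exact h

lemma tendsto_thetaTwo : Tendsto thetaTwo atTop (𝓝 0) := by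
  have h := tendsto_tsum_of_dominated_convergence (𝓕 := atTop)
    (f := fun (s : ℝ) (n : ℤ) => Real.exp (-Real.pi * s * ((n : ℝ) + 1 / 2) ^ 2))
    (g := fun n : ℤ => (0 : ℝ)) (summable_thetaTwo one_pos)
    (fun n => by
      have hn : (n : ℝ) + 1 / 2 ≠ 0 := by
        intro h
        have : ((2 * n + 1 : ℤ) : ℝ) = 0 := by push_cast; linarith
        have := Int.cast_eq_zero.1 this
        omega
      have : 0 < Real.pi * ((n : ℝ) + 1 / 2) ^ 2 := by positivity
      refine Real.tendsto_exp_atBot.comp ?_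
      have := (tendsto_id (α := ℝ) (x := atTop)).const_mul_atTop_of_neg (neg_neg_of_pos this)
      refine this.congr fun s => ?_
      simp only [id]; ring)
    (by
      filter_upwards [eventually_ge_atTop 1] with s hs n
      rw [Real.norm_of_nonneg (Real.exp_pos _).le, Real.exp_le_exp]
      have : 0 < Real.pi := Real.pi_pos
      nlinarith [mul_nonneg this.le (mul_nonneg (sub_nonneg.2 hs) (sq_nonneg ((n : ℝ) + 1 / 2)))])
  simp only [tsum_zero] at h
  exact h

lemma tendsto_two_pow_mul {s : ℝ} (hs : 0 < s) :
    Tendsto (fun n : ℕ => 2 ^ n * s) atTop atTop :=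
  (tendsto_pow_atTop_atTop_of_one_lt one_lt_two).atTop_mul_const hs

/-! ### The singular modulus through theta constants. -/

/-- The elliptic modulus with `K' / K = s`. -/
noncomputable def thetaModulus (s : ℝ) : ℝ := thetaTwo s ^ 2 / thetaThree s ^ 2

lemma thetaModulus_pos {s : ℝ} (hs : 0 < s) : 0 < thetaModulus s := by
  have := thetaTwo_pos hs
  have := thetaThree_pos hs
  rw [thetaModulus]; positivity

lemma thetaModulus_inv {s : ℝ} (hs : 0 < s) :
    thetaModulus s⁻¹ = thetaFour s ^ 2 / thetaThree s ^ 2 := by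
  have := (Real.sqrt_pos.2 hs).ne'
  have := (thetaThree_pos hs).ne'
  rw [thetaModulus, thetaThree_inv hs, thetaTwo_inv hs]
  field_simp

lemma thetaModulus_sq_add {s : ℝ} (hs : 0 < s) :
    thetaModulus s ^ 2 + thetaModulus s⁻¹ ^ 2 = 1 := by
  have := (thetaThree_pos hs).ne'
  rw [thetaModulus_inv hs, thetaModulus]
  field_simp
  linarith [thetaThree_pow_four hs]

lemma thetaModulus_lt_one {s : ℝ} (hs : 0 < s) : thetaModulus s < 1 := by
  nlinarith [thetaModulus_sq_add hs, thetaModulus_pos hs, thetaModulus_pos (inv_pos.2 hs)]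

/-- Landen's transformation with `t = thetaModulus (2 * s)`, for which `1 + t = θ₃(s)²/θ₃(2s)²`. -/
lemma ellipticF_thetaModulus_two_mul {s : ℝ} (hs : 0 < s) :
    ellipticF (thetaModulus s ^ 2) / thetaThree s ^ 2 =
      ellipticF (thetaModulus (2 * s) ^ 2) / thetaThree (2 * s) ^ 2 := by
  have h2 : 0 < 2 * s := by positivity
  have p3 := thetaThree_pos h2
  have p2 := thetaTwo_pos h2
  have p := thetaThree_pos hs
  have h1 : 1 + thetaModulus (2 * s) = thetaThree s ^ 2 / thetaThree (2 * s) ^ 2 := by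
    rw [thetaModulus, thetaThree_sq hs]; field_simp
  have hk : thetaModulus s ^ 2 = 4 * thetaModulus (2 * s) / (1 + thetaModulus (2 * s)) ^ 2 := by
    rw [h1, thetaModulus, thetaTwo_sq hs, thetaModulus]
    field_simp
    ring
  rw [hk, ellipticF_landen (thetaModulus_pos h2).le (thetaModulus_lt_one h2), h1]
  field_simp

/-- The quotient by `θ₃²` is constant along `2ⁿ s`, where the modulus tends to `0` and the quotient
to `1`. -/
lemma ellipticF_thetaModulus {s : ℝ} (hs : 0 < s) :
    ellipticF (thetaModulus s ^ 2) = thetaThree s ^ 2 := by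
  have hpos (n : ℕ) : 0 < 2 ^ n * s := by positivity
  have hconst (n : ℕ) : ellipticF (thetaModulus (2 ^ n * s) ^ 2) / thetaThree (2 ^ n * s) ^ 2 =
      ellipticF (thetaModulus s ^ 2) / thetaThree s ^ 2 := by
    induction n with
    | zero => simp
    | succ n ih =>
      rw [← ih, ellipticF_thetaModulus_two_mul (hpos n), pow_succ (2 : ℝ) n, mul_comm ((2 : ℝ) ^ n) 2,
        mul_assoc]
  have ht3 := (tendsto_thetaThree.comp (tendsto_two_pow_mul hs)).pow 2
  have ht2 := (tendsto_thetaTwo.comp (tendsto_two_pow_mul hs)).pow 2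
  have htk := (ht2.div ht3 (by norm_num)).pow 2
  have hF := tendsto_ellipticF (f := fun n => thetaModulus (2 ^ n * s) ^ 2)
    (fun n => sq_nonneg _)
    (fun n => pow_lt_one₀ (thetaModulus_pos (hpos n)).le (thetaModulus_lt_one (hpos n)) two_ne_zero)
    (by simpa [thetaModulus, Function.comp_def] using htk)
  have hlim := hF.div ht3 (by norm_num)
  have := tendsto_nhds_unique
    (hlim.congr (f₂ := fun _ => ellipticF (thetaModulus s ^ 2) / thetaThree s ^ 2) hconst)
    tendsto_const_nhds
  have p := thetaThree_pos hs
  rw [one_pow, div_one, eq_div_iff (by positivity), one_mul] at this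
  exact this.symm

lemma ellipticK_thetaModulus {s : ℝ} (hs : 0 < s) :
    ellipticK (thetaModulus s) = Real.pi / 2 * thetaThree s ^ 2 := by
  rw [ellipticK_eq, ellipticF_thetaModulus hs]

/-- The complementary modulus is the modulus at `s⁻¹`, and `θ₃(s⁻¹)² = s θ₃(s)²`. -/
lemma ellipticK'_thetaModulus {s : ℝ} (hs : 0 < s) :
    ellipticK' (thetaModulus s) = s * ellipticK (thetaModulus s) := by
  have h : √(1 - thetaModulus s ^ 2) = thetaModulus s⁻¹ := by
    rw [← thetaModulus_sq_add hs, add_sub_cancel_left,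
      Real.sqrt_sq (thetaModulus_pos (inv_pos.2 hs)).le]
  rw [ellipticK', h, ellipticK_thetaModulus (inv_pos.2 hs), thetaThree_inv hs, mul_pow,
    Real.sq_sqrt hs.le, ellipticK_thetaModulus hs]
  ring

lemma isSingularModulus_thetaModulus {r : ℝ} (hr : 0 < r) :
    IsSingularModulus r (thetaModulus √r) := by
  have hs := Real.sqrt_pos.2 hr
  have hk := thetaModulus_pos hs
  have hk' := thetaModulus_lt_one hs
  refine ⟨hk, hk', ?_⟩
  rw [ellipticK'_thetaModulus hs, mul_div_cancel_right₀ _ (ellipticK_pos hk.le hk').ne']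

lemma ellipticK'_div_ellipticK_lt {x y : ℝ} (h0 : 0 < x) (hxy : x < y) (h1 : y < 1) :
    ellipticK' y / ellipticK y < ellipticK' x / ellipticK x := by
  have hy0 := h0.trans hxy
  have hx1 := hxy.trans h1
  have ha : √(1 - y ^ 2) < √(1 - x ^ 2) :=
    Real.sqrt_lt_sqrt (by nlinarith) (by nlinarith)
  have hb : √(1 - x ^ 2) < 1 := by
    rw [Real.sqrt_lt' one_pos]; nlinarith
  have h := ellipticK_lt (Real.sqrt_nonneg _) ha hb
  exact div_lt_div₀ h (ellipticK_lt h0.le hxy h1).le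
    (ellipticK_pos (Real.sqrt_nonneg _) hb).le (ellipticK_pos h0.le hx1)

lemma IsSingularModulus.unique {r k l : ℝ} (hk : IsSingularModulus r k)
    (hl : IsSingularModulus r l) : k = l := by
  rcases lt_trichotomy k l with h | h | h
  · have := ellipticK'_div_ellipticK_lt hk.1 h hl.2.1
    rw [hk.2.2, hl.2.2] at this
    exact absurd this (lt_irrefl _)
  · exact h
  · have := ellipticK'_div_ellipticK_lt hl.1 h hk.2.1
    rw [hk.2.2, hl.2.2] at this
    exact absurd this (lt_irrefl _)

/-! ### The Lambert series of `θ₃²`. -/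

/-- The Lambert series `∑ sech (π s n)` over the integers. -/
noncomputable def sechSum (s : ℝ) : ℝ := ∑' n : ℤ, (Real.cosh (Real.pi * s * n))⁻¹

/-- The alternating Lambert series `∑ (-1)ⁿ sech (π s n)` over the integers. -/
noncomputable def altSechSum (s : ℝ) : ℝ :=
  ∑' n : ℤ, (-1 : ℝ) ^ n * (Real.cosh (Real.pi * s * n))⁻¹

lemma inv_cosh_le (x : ℝ) : (Real.cosh x)⁻¹ ≤ 2 * Real.exp (-|x|) := by
  rw [inv_le_comm₀ (Real.cosh_pos x) (by positivity), mul_inv, ← Real.exp_neg, neg_neg,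
    ← Real.cosh_abs, Real.cosh_eq]
  linarith [Real.exp_pos (-|x|)]

lemma inv_cosh_pos (x : ℝ) : 0 < (Real.cosh x)⁻¹ := inv_pos.2 (Real.cosh_pos x)

lemma inv_cosh_le_one (x : ℝ) : (Real.cosh x)⁻¹ ≤ 1 := inv_le_one_of_one_le₀ (Real.one_le_cosh x)

lemma summable_sechSum {s : ℝ} (hs : 0 < s) :
    Summable fun n : ℤ => (Real.cosh (Real.pi * s * n))⁻¹ := by
  have hc : 0 < Real.pi * s := by positivity
  refine Summable.of_nonneg_of_le (fun n => (inv_cosh_pos _).le) (fun n => ?_)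
    ((summable_exp_neg_mul_abs_int hc).mul_left 2)
  refine (inv_cosh_le _).trans_eq ?_
  rw [abs_mul, abs_of_pos hc, neg_mul]

lemma summable_altSechSum {s : ℝ} (hs : 0 < s) :
    Summable fun n : ℤ => (-1 : ℝ) ^ n * (Real.cosh (Real.pi * s * n))⁻¹ := by
  refine Summable.of_norm_bounded (summable_sechSum hs) fun n => ?_
  rw [Real.norm_eq_abs, abs_neg_one_zpow_mul, abs_of_pos (inv_cosh_pos _)]

lemma sechSum_add_altSechSum {s : ℝ} (hs : 0 < s) :
    sechSum s + altSechSum s = 2 * sechSum (2 * s) := by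
  rw [sechSum, altSechSum, ← (summable_sechSum hs).tsum_add (summable_altSechSum hs), sechSum,
    ← tsum_mul_left]
  have hinj : Function.Injective fun n : ℤ => 2 * n := fun a b h => by dsimp only at h; omega
  rw [← hinj.tsum_eq]
  · refine tsum_congr fun n => ?_
    rw [(even_two_mul n).neg_one_zpow]
    push_cast
    rw [show Real.pi * s * (2 * n) = Real.pi * (2 * s) * n by ring]
    ring
  · intro n hn
    rcases Int.even_or_odd' n with ⟨k, h | h⟩
    · exact ⟨k, h.symm⟩
    · refine absurd ?_ hn
      dsimp only
      rw [Odd.neg_one_zpow ⟨k, h⟩]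
      ring

/-- The shifted alternating sums `∑ (-1)ʲ exp (-π s (j² + 2 j k)) sech (π s j)`. -/
noncomputable def gaussSechSum (s : ℝ) (k : ℤ) : ℝ :=
  ∑' j : ℤ, (-1 : ℝ) ^ j * Real.exp (-Real.pi * s * ((j : ℝ) ^ 2 + 2 * j * k)) *
    (Real.cosh (Real.pi * s * j))⁻¹

lemma summable_gauss_shift {s : ℝ} (hs : 0 < s) (k : ℤ) :
    Summable fun j : ℤ => Real.exp (-Real.pi * s * ((j : ℝ) ^ 2 + 2 * j * k)) := by
  have h := ((Equiv.addRight k).summable_iff.2 (summable_thetaThree hs)).mul_left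
    (Real.exp (Real.pi * s * (k : ℝ) ^ 2))
  refine h.congr fun j => ?_
  rw [Function.comp_apply, ← Real.exp_add, Equiv.coe_addRight]
  congr 1
  push_cast
  ring

lemma summable_gaussSechSum {s : ℝ} (hs : 0 < s) (k : ℤ) :
    Summable fun j : ℤ => (-1 : ℝ) ^ j * Real.exp (-Real.pi * s * ((j : ℝ) ^ 2 + 2 * j * k)) *
    (Real.cosh (Real.pi * s * j))⁻¹ := by
  refine Summable.of_norm_bounded (summable_gauss_shift hs k) fun j => ?_
  rw [norm_mul, Real.norm_eq_abs, abs_neg_one_zpow_mul, Real.norm_eq_abs,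
    abs_of_pos (Real.exp_pos _), abs_of_pos (inv_cosh_pos _)]
  exact mul_le_of_le_one_right (Real.exp_pos _).le (inv_cosh_le_one _)

/-- The reflection `j ↦ -(2k + 1) - j` fixes the exponent and reverses the sign. -/
lemma tsum_alternating_gauss_eq_zero (s : ℝ) (k : ℤ) :
    ∑' j : ℤ, (-1 : ℝ) ^ j * Real.exp (-Real.pi * s * ((j : ℝ) ^ 2 + (2 * k + 1) * j)) = 0 := by
  have h := (Equiv.subLeft (-(2 * k + 1))).tsum_eq
    (fun j : ℤ => (-1 : ℝ) ^ j * Real.exp (-Real.pi * s * ((j : ℝ) ^ 2 + (2 * k + 1) * j)))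
  have h2 : ∑' j : ℤ, (-1 : ℝ) ^ (Equiv.subLeft (-(2 * k + 1)) j) *
      Real.exp (-Real.pi * s * (((Equiv.subLeft (-(2 * k + 1)) j : ℤ) : ℝ) ^ 2 +
        (2 * k + 1) * (Equiv.subLeft (-(2 * k + 1)) j : ℤ))) =
      -∑' j : ℤ, (-1 : ℝ) ^ j * Real.exp (-Real.pi * s * ((j : ℝ) ^ 2 + (2 * k + 1) * j)) := by
    rw [← tsum_neg]
    refine tsum_congr fun j => ?_
    rw [Equiv.subLeft_apply, zpow_sub₀ (by norm_num), Odd.neg_one_zpow ⟨-k - 1, by ring⟩,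
      neg_div, one_div, ← inv_zpow, inv_neg_one, neg_mul]
    congr 3
    push_cast
    ring
  rw [h2] at h
  linarith

/-- Adding neighbouring sums produces `e^(πsj) + e^(-πsj)`, which cancels the `sech` and leaves a
vanishing alternating Gaussian sum. -/
lemma gaussSechSum_succ {s : ℝ} (hs : 0 < s) (k : ℤ) :
    gaussSechSum s (k + 1) = -gaussSechSum s k := by
  rw [eq_neg_iff_add_eq_zero, gaussSechSum, gaussSechSum,
    ← (summable_gaussSechSum hs (k + 1)).tsum_add (summable_gaussSechSum hs k),
    ← mul_zero (2 : ℝ), ← tsum_alternating_gauss_eq_zero s k, ← tsum_mul_left]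
  refine tsum_congr fun j => ?_
  have h1 : Real.exp (-Real.pi * s * ((j : ℝ) ^ 2 + 2 * j * (k + 1 : ℤ))) =
      Real.exp (-Real.pi * s * ((j : ℝ) ^ 2 + (2 * k + 1) * j)) * Real.exp (-(Real.pi * s * j)) := by
    rw [← Real.exp_add]; congr 1; push_cast; ring
  have h2 : Real.exp (-Real.pi * s * ((j : ℝ) ^ 2 + 2 * j * k)) =
      Real.exp (-Real.pi * s * ((j : ℝ) ^ 2 + (2 * k + 1) * j)) * Real.exp (Real.pi * s * j) := by
    rw [← Real.exp_add]; congr 1; ring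
  have h3 := (Real.cosh_pos (Real.pi * s * j)).ne'
  rw [h1, h2]
  field_simp
  rw [Real.cosh_eq]
  ring

lemma gaussSechSum_eq {s : ℝ} (hs : 0 < s) (k : ℤ) :
    gaussSechSum s k = (-1 : ℝ) ^ k * gaussSechSum s 0 := by
  induction k with
  | zero => simp
  | succ i ih => rw [gaussSechSum_succ hs, ih, zpow_add_one₀ (by norm_num)]; ring
  | pred i ih =>
    have h := gaussSechSum_succ hs (-(i : ℤ) - 1)
    rw [sub_add_cancel, ih] at h
    rw [zpow_sub_one₀ (by norm_num)]
    linarith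

/-- Put `m = k + j` and split `m² = k² + (j² + 2jk)`. The sign `(-1)^k` from the shift cancels the
one from `gaussSechSum_eq`, so the convolution is again Gaussian in `k`. -/
lemma tsum_gauss_mul_sech {s : ℝ} (hs : 0 < s) (k : ℤ) :
    ∑' m : ℤ, (-1 : ℝ) ^ m * Real.exp (-Real.pi * s * (m : ℝ) ^ 2) *
      (Real.cosh (Real.pi * s * (k - m : ℤ)))⁻¹ =
      Real.exp (-Real.pi * s * (k : ℝ) ^ 2) * gaussSechSum s 0 := by
  rw [← (Equiv.addRight k).tsum_eq]
  have hk : gaussSechSum s 0 = (-1 : ℝ) ^ k * gaussSechSum s k := by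
    rw [gaussSechSum_eq hs k, ← mul_assoc, ← mul_zpow]
    norm_num
  rw [hk, gaussSechSum, ← mul_assoc, ← tsum_mul_left]
  refine tsum_congr fun j => ?_
  have h1 : Real.exp (-Real.pi * s * ((Equiv.addRight k j : ℤ) : ℝ) ^ 2) =
      Real.exp (-Real.pi * s * (k : ℝ) ^ 2) *
        Real.exp (-Real.pi * s * ((j : ℝ) ^ 2 + 2 * j * k)) := by
    rw [← Real.exp_add, Equiv.coe_addRight]; congr 1; push_cast; ring
  have h2 : Real.cosh (Real.pi * s * ((k - Equiv.addRight k j : ℤ) : ℝ)) =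
      Real.cosh (Real.pi * s * j) := by
    rw [← Real.cosh_neg, Equiv.coe_addRight]; congr 1; push_cast; ring
  rw [h1, h2, Equiv.coe_addRight, zpow_add₀ (by norm_num)]
  ring

/-- The product of two sums over `ℤ` as a sum of convolutions. -/
lemma tsum_mul_tsum_int_convolution {f g : ℤ → ℝ} (hf : Summable f) (hg : Summable g) :
    (∑' n, f n) * ∑' n, g n = ∑' k : ℤ, ∑' m : ℤ, f m * g (k - m) := by
  let e : ℤ × ℤ ≃ ℤ × ℤ :=
    { toFun := fun p => (p.2, p.1 - p.2)
      invFun := fun p => (p.1 + p.2, p.1)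
      left_inv := fun p => by ext <;> simp
      right_inv := fun p => by ext <;> simp }
  have hs := e.summable_iff.2 (summable_mul_int_prod hf hg)
  rw [tsum_mul_tsum_int hf hg, ← e.tsum_eq]
  exact hs.tsum_prod

lemma thetaFour_mul_sechSum {s : ℝ} (hs : 0 < s) :
    thetaFour s * sechSum s = thetaThree s * gaussSechSum s 0 := by
  rw [thetaFour, sechSum, tsum_mul_tsum_int_convolution (summable_thetaFour hs)
    (summable_sechSum hs), thetaThree, ← tsum_mul_right]
  exact tsum_congr fun k => tsum_gauss_mul_sech hs k

lemma thetaThree_mul_altSechSum {s : ℝ} (hs : 0 < s) :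
    thetaThree s * altSechSum s = thetaFour s * gaussSechSum s 0 := by
  rw [thetaThree, altSechSum, tsum_mul_tsum_int_convolution (summable_thetaThree hs)
    (summable_altSechSum hs), thetaFour, ← tsum_mul_right]
  refine tsum_congr fun k => ?_
  rw [mul_assoc, ← tsum_gauss_mul_sech hs k, ← tsum_mul_left]
  refine tsum_congr fun m => ?_
  have : (-1 : ℝ) ^ (k - m) = (-1) ^ k * (-1) ^ m := by
    rw [zpow_sub₀ (by norm_num), div_eq_mul_inv, ← inv_zpow, inv_neg_one]
  rw [this]
  ring

/-- Eliminating `gaussSechSum s 0` from the two product identities gives `h5`; averaging the sums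
and the squares `θ₃²`, `θ₄²` doubles `s`. -/
lemma sechSum_div_two_mul {s : ℝ} (hs : 0 < s) :
    sechSum s / thetaThree s ^ 2 = sechSum (2 * s) / thetaThree (2 * s) ^ 2 := by
  have p := thetaThree_pos hs
  have p' := thetaThree_pos (s := 2 * s) (by positivity)
  have p4 := thetaFour_pos hs
  have h1 := thetaFour_mul_sechSum hs
  have h2 := thetaThree_mul_altSechSum hs
  have h3 := sechSum_add_altSechSum hs
  have h4 : thetaThree s ^ 2 + thetaFour s ^ 2 = 2 * thetaThree (2 * s) ^ 2 := by
    rw [thetaThree_sq hs, thetaFour_sq hs]; ring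
  have h5 : altSechSum s * thetaThree s ^ 2 = sechSum s * thetaFour s ^ 2 := by
    linear_combination thetaThree s * h2 - thetaFour s * h1
  rw [div_eq_div_iff (by positivity) (by positivity)]
  linear_combination (-sechSum s / 2) * h4 + thetaThree s ^ 2 / 2 * h3 - h5 / 2

lemma tendsto_sechSum : Tendsto sechSum atTop (𝓝 1) := by
  have h := tendsto_tsum_of_dominated_convergence (𝓕 := atTop)
    (f := fun (s : ℝ) (n : ℤ) => (Real.cosh (Real.pi * s * n))⁻¹)
    (g := fun n : ℤ => if n = 0 then (1 : ℝ) else 0) (summable_sechSum one_pos)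
    (fun n => by
      split_ifs with hn
      · simp [hn]
      · have hn' : 0 < Real.pi * |(n : ℝ)| := by positivity
        have h1 : Tendsto (fun s : ℝ => 2 * Real.exp (-|Real.pi * s * n|)) atTop (𝓝 0) := by
          rw [← mul_zero (2 : ℝ)]
          refine (Real.tendsto_exp_atBot.comp (tendsto_neg_atTop_atBot.comp ?_)).const_mul 2
          refine ((tendsto_id (α := ℝ) (x := atTop)).const_mul_atTop hn').congr' ?_
          filter_upwards [eventually_ge_atTop 0] with s hs
          rw [abs_mul, abs_mul, abs_of_pos Real.pi_pos, abs_of_nonneg hs, id]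
          ring
        exact squeeze_zero (fun s => (inv_cosh_pos _).le) (fun s => inv_cosh_le _) h1)
    (by
      filter_upwards [eventually_ge_atTop 1] with s hs n
      rw [Real.norm_of_nonneg (inv_cosh_pos _).le]
      refine inv_anti₀ (Real.cosh_pos _) (Real.cosh_le_cosh.2 ?_)
      rw [abs_mul, abs_mul, abs_mul, abs_mul, abs_of_pos Real.pi_pos, abs_one,
        abs_of_pos (one_pos.trans_le hs)]
      gcongr)
  simp only [tsum_ite_eq] at h
  exact h

/-- Jacobi's Lambert series for `θ₃²`. -/
lemma sechSum_eq {s : ℝ} (hs : 0 < s) : sechSum s = thetaThree s ^ 2 := by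
  have hpos (n : ℕ) : 0 < 2 ^ n * s := by positivity
  have hconst (n : ℕ) : sechSum (2 ^ n * s) / thetaThree (2 ^ n * s) ^ 2 =
      sechSum s / thetaThree s ^ 2 := by
    induction n with
    | zero => simp
    | succ n ih =>
      rw [← ih, sechSum_div_two_mul (hpos n), pow_succ (2 : ℝ) n, mul_comm ((2 : ℝ) ^ n) 2,
        mul_assoc]
  have hlim := (tendsto_sechSum.comp (tendsto_two_pow_mul hs)).div
    ((tendsto_thetaThree.comp (tendsto_two_pow_mul hs)).pow 2) (by norm_num)
  have := tendsto_nhds_unique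
    (hlim.congr (f₂ := fun _ => sechSum s / thetaThree s ^ 2) hconst) tendsto_const_nhds
  have p := thetaThree_pos hs
  rw [one_pow, div_one, eq_div_iff (by positivity), one_mul] at this
  exact this.symm

/-! ### The auxiliary series: resummation, singularities, special values. -/

/-- The series `∑ x / (1 + x²)` over `x = ρ ^ (2 m + 1) w`. -/
noncomputable def oddPowerSum (ρ : ℝ) (w : ℂ) : ℂ :=
  ∑' m : ℕ, ((ρ : ℂ) ^ (2 * m + 1) * w) / (1 + ((ρ : ℂ) ^ (2 * m + 1) * w) ^ 2)

/-- Both sides sum one double series `D (n, m)`: geometric in `m` along rows, geometric in `n` along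
columns. -/
lemma hasSum_oddPowerSum {ρ : ℝ} {w : ℂ} (h0 : 0 < ρ) (h1 : ρ < 1) (hw : ρ * ‖w‖ < 1) :
    HasSum (fun n : ℕ => (-1) ^ n * (ρ : ℂ) ^ (2 * n + 1) * w ^ (2 * n + 3) /
      (1 - ((ρ : ℂ) ^ 2) ^ (2 * n + 1))) (w ^ 2 * oddPowerSum ρ w) := by
  set D : ℕ × ℕ → ℂ := fun p => w ^ 2 * ((-1) ^ p.1 * ((ρ : ℂ) ^ (2 * p.2 + 1) * w) ^ (2 * p.1 + 1))
  have hnρ : ‖(ρ : ℂ)‖ = ρ := by simp [abs_of_pos h0]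
  have hq1 : ρ ^ 2 < 1 := pow_lt_one₀ h0.le h1 two_ne_zero
  have hpow : (ρ * ‖w‖) ^ 2 < 1 := pow_lt_one₀ (by positivity) hw two_ne_zero
  have hsum : Summable D := by
    -- The mixed factor `(ρ²)^(m(2n+1))` is relaxed to `(ρ²)^m`, so that the majorant is a product
    -- of geometric series.
    refine Summable.of_norm_bounded (g := fun p : ℕ × ℕ =>
      (‖w‖ ^ 2 * (ρ * ‖w‖) * ((ρ * ‖w‖) ^ 2) ^ p.1) * (ρ ^ 2) ^ p.2) ?_ fun p => ?_
    · refine Summable.mul_of_nonneg (f := fun n : ℕ => ‖w‖ ^ 2 * (ρ * ‖w‖) * ((ρ * ‖w‖) ^ 2) ^ n)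
        ((summable_geometric_of_lt_one (by positivity) hpow).mul_left _)
        (summable_geometric_of_lt_one (by positivity) hq1) (fun _ => by positivity)
        (fun _ => by positivity)
    · have h : ‖D p‖ = (‖w‖ ^ 2 * (ρ * ‖w‖) * ((ρ * ‖w‖) ^ 2) ^ p.1) *
          ((ρ ^ 2) ^ p.2) ^ (2 * p.1 + 1) := by
        simp only [D, norm_mul, norm_pow, hnρ, norm_neg, norm_one, one_pow]
        ring
      rw [h]
      gcongr
      exact pow_le_of_le_one (by positivity) (pow_le_one₀ (by positivity) hq1.le) (by omega)
  have hrow (n : ℕ) : HasSum (fun m => D (n, m)) ((-1) ^ n * (ρ : ℂ) ^ (2 * n + 1) *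
      w ^ (2 * n + 3) / (1 - ((ρ : ℂ) ^ 2) ^ (2 * n + 1))) := by
    have hlt : ‖((ρ : ℂ) ^ 2) ^ (2 * n + 1)‖ < 1 := by
      rw [norm_pow, norm_pow, hnρ]
      exact pow_lt_one₀ (by positivity) hq1 (by omega)
    have h := (hasSum_geometric_of_norm_lt_one hlt).mul_left
      ((-1) ^ n * (ρ : ℂ) ^ (2 * n + 1) * w ^ (2 * n + 3))
    rw [← div_eq_mul_inv] at h
    refine h.congr_fun fun m => ?_
    simp only [D]
    ring
  have hcol (m : ℕ) : HasSum (fun n => D (n, m)) (w ^ 2 * (((ρ : ℂ) ^ (2 * m + 1) * w) /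
      (1 + ((ρ : ℂ) ^ (2 * m + 1) * w) ^ 2))) := by
    set x : ℂ := (ρ : ℂ) ^ (2 * m + 1) * w
    have hx : ‖x‖ < 1 := by
      rw [norm_mul, norm_pow, hnρ]
      refine lt_of_le_of_lt ?_ hw
      gcongr
      exact pow_le_of_le_one h0.le h1.le (by omega)
    have hlt : ‖-x ^ 2‖ < 1 := by
      rw [norm_neg, norm_pow]
      exact pow_lt_one₀ (norm_nonneg _) hx two_ne_zero
    have h := ((hasSum_geometric_of_norm_lt_one hlt).mul_left x).mul_left (w ^ 2)
    rw [sub_neg_eq_add, ← div_eq_mul_inv] at h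
    refine h.congr_fun fun n => ?_
    simp only [D]
    rw [neg_pow (x ^ 2)]
    ring
  have hA := hsum.hasSum.prod_fiberwise hrow
  have hB := ((Equiv.prodComm ℕ ℕ).hasSum_iff.2 hsum.hasSum).prod_fiberwise hcol
  rwa [oddPowerSum, ← tsum_mul_left, hB.tsum_eq]

/-- Locally only finitely many terms can have a pole; the tail converges uniformly to an analytic
function. -/
lemma oddPowerSum_eventually_eq {ρ : ℝ} (h0 : 0 < ρ) (h1 : ρ < 1) (w₀ : ℂ) :
    ∃ (M : ℕ) (T : ℂ → ℂ), AnalyticAt ℂ T w₀ ∧ ∀ᶠ w in 𝓝 w₀, oddPowerSum ρ w =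
      (∑ m ∈ range M, ((ρ : ℂ) ^ (2 * m + 1) * w) / (1 + ((ρ : ℂ) ^ (2 * m + 1) * w) ^ 2)) +
        T w := by
  have hnρ : ‖(ρ : ℂ)‖ = ρ := by simp [abs_of_pos h0]
  have hq1 : ρ ^ 2 < 1 := pow_lt_one₀ h0.le h1 two_ne_zero
  have hw0 : 0 < ‖w₀‖ + 1 := by positivity
  -- This `M` forces `|x| ≤ 1/2` for every tail term on the unit ball about `w₀`, which keeps `1 +
  -- x²` away from `0`.
  obtain ⟨M, hM⟩ := exists_pow_lt_of_lt_one (show 0 < 1 / (2 * (‖w₀‖ + 1)) by positivity) hq1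
  rw [lt_div_iff₀ (by positivity)] at hM
  set F : ℕ → ℂ → ℂ := fun m w =>
    ((ρ : ℂ) ^ (2 * m + 1) * w) / (1 + ((ρ : ℂ) ^ (2 * m + 1) * w) ^ 2)
  have hx (m : ℕ) {w : ℂ} (hw : w ∈ Metric.ball w₀ 1) :
      ‖(ρ : ℂ) ^ (2 * (m + M) + 1) * w‖ ≤ 1 / 2 * (ρ ^ 2) ^ m := by
    have hwn : ‖w‖ ≤ ‖w₀‖ + 1 := by
      have := norm_sub_norm_le w w₀
      rw [Metric.mem_ball, dist_eq_norm] at hw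
      linarith
    rw [norm_mul, norm_pow, hnρ]
    calc ρ ^ (2 * (m + M) + 1) * ‖w‖ = ρ * ((ρ ^ 2) ^ M * ‖w‖) * (ρ ^ 2) ^ m := by ring
      _ ≤ 1 * ((ρ ^ 2) ^ M * (‖w₀‖ + 1)) * (ρ ^ 2) ^ m := by gcongr
      _ ≤ 1 / 2 * (ρ ^ 2) ^ m := by gcongr; linarith
  have hx' (m : ℕ) {w : ℂ} (hw : w ∈ Metric.ball w₀ 1) :
      1 / 2 ≤ ‖1 + ((ρ : ℂ) ^ (2 * (m + M) + 1) * w) ^ 2‖ := by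
    have h := norm_sub_le_norm_add (1 : ℂ) (((ρ : ℂ) ^ (2 * (m + M) + 1) * w) ^ 2)
    have h' : ‖(ρ : ℂ) ^ (2 * (m + M) + 1) * w‖ ≤ 1 / 2 :=
      (hx m hw).trans (mul_le_of_le_one_right (by norm_num) (pow_le_one₀ (by positivity) hq1.le))
    rw [norm_one, norm_pow] at h
    nlinarith [norm_nonneg ((ρ : ℂ) ^ (2 * (m + M) + 1) * w)]
  have hbound (m : ℕ) (w : ℂ) (hw : w ∈ Metric.ball w₀ 1) : ‖F (m + M) w‖ ≤ (ρ ^ 2) ^ m := by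
    rw [norm_div, div_le_iff₀ (by linarith [hx' m hw])]
    refine (hx m hw).trans ?_
    rw [mul_comm]
    exact mul_le_mul_of_nonneg_left (hx' m hw) (by positivity)
  have hgeo := summable_geometric_of_lt_one (by positivity) hq1
  have hdiff : DifferentiableOn ℂ (fun w => ∑' m, F (m + M) w) (Metric.ball w₀ 1) := by
    refine Complex.differentiableOn_tsum_of_summable_norm hgeo (fun m w hw => ?_)
      Metric.isOpen_ball hbound
    have hne : 1 + ((ρ : ℂ) ^ (2 * (m + M) + 1) * w) ^ 2 ≠ 0 := by
      rw [← norm_pos_iff]; linarith [hx' m hw]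
    have : DifferentiableAt ℂ (F (m + M)) w := by
      simp only [F]
      fun_prop (disch := assumption)
    exact this.differentiableWithinAt
  refine ⟨M, fun w => ∑' m, F (m + M) w,
    hdiff.analyticAt (Metric.ball_mem_nhds w₀ one_pos), ?_⟩
  filter_upwards [Metric.ball_mem_nhds w₀ one_pos] with w hw
  have hs : Summable fun m => F (m + M) w := Summable.of_norm_bounded hgeo fun m => hbound m w hw
  exact (hs.sum_add_tsum_nat_add' (f := fun m => F m w)).symm

lemma meromorphicAt_oddPowerSum {ρ : ℝ} (h0 : 0 < ρ) (h1 : ρ < 1) (w₀ : ℂ) :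
    MeromorphicAt (oddPowerSum ρ) w₀ := by
  obtain ⟨M, T, hT, h⟩ := oddPowerSum_eventually_eq h0 h1 w₀
  refine MeromorphicAt.congr ?_ (EventuallyEq.symm (h.filter_mono nhdsWithin_le_nhds))
  have hm (m : ℕ) : MeromorphicAt (fun w : ℂ => ((ρ : ℂ) ^ (2 * m + 1) * w) /
      (1 + ((ρ : ℂ) ^ (2 * m + 1) * w) ^ 2)) w₀ := by fun_prop
  exact MeromorphicAt.add (MeromorphicAt.fun_sum fun m _ => hm m) hT.meromorphicAt

lemma analyticAt_oddPowerSum {ρ : ℝ} (h0 : 0 < ρ) (h1 : ρ < 1) {w₀ : ℂ}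
    (hw : ∀ m : ℕ, 1 + ((ρ : ℂ) ^ (2 * m + 1) * w₀) ^ 2 ≠ 0) :
    AnalyticAt ℂ (oddPowerSum ρ) w₀ := by
  obtain ⟨M, T, hT, h⟩ := oddPowerSum_eventually_eq h0 h1 w₀
  refine AnalyticAt.congr ?_ (EventuallyEq.symm h)
  refine AnalyticAt.add (Finset.analyticAt_fun_sum _ fun m _ => ?_) hT
  exact AnalyticAt.div (by fun_prop) (by fun_prop) (hw m)

lemma one_add_sq_ne_zero_of_re_pos {x : ℂ} (hx : 0 < x.re) : 1 + x ^ 2 ≠ 0 := by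
  intro h
  have : (x - Complex.I) * (x + Complex.I) = 0 := by
    linear_combination h - Complex.I_sq
  rcases mul_eq_zero.1 this with h | h
  · have := congrArg Complex.re h
    simp at this
    linarith
  · have := congrArg Complex.re h
    simp at this
    linarith

lemma one_add_sq_ne_zero_of_norm_lt_one {x : ℂ} (hx : ‖x‖ < 1) : 1 + x ^ 2 ≠ 0 := by
  intro h
  have h2 : x ^ 2 = -1 := by linear_combination h
  have := pow_lt_one₀ (norm_nonneg _) hx two_ne_zero
  rw [← norm_pow, h2] at this
  simp at this

lemma exp_neg_pow_div_one_add_sq (a : ℝ) (m : ℕ) :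
    (Real.exp (-a) ^ m / (1 + (Real.exp (-a) ^ m) ^ 2)) = (Real.cosh (a * m))⁻¹ / 2 := by
  have h : Real.exp (-a) ^ m = Real.exp (-(a * m)) := by
    rw [← Real.exp_nat_mul]; congr 1; ring
  rw [h, Real.cosh_eq, Real.exp_neg]
  have := Real.exp_pos (a * m)
  field_simp

lemma oddPowerSum_self (s : ℝ) :
    oddPowerSum (Real.exp (-(Real.pi * s / 2))) (Real.exp (-(Real.pi * s / 2)) : ℝ) =
      ((∑' m : ℕ, (Real.cosh (Real.pi * s * ((m + 1 : ℕ) : ℝ)))⁻¹ / 2 : ℝ) : ℂ) := by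
  rw [oddPowerSum, Complex.ofReal_tsum]
  refine tsum_congr fun m => ?_
  have h : Real.exp (-(Real.pi * s / 2)) ^ (2 * m + 1) * Real.exp (-(Real.pi * s / 2)) =
      Real.exp (-(Real.pi * s)) ^ (m + 1) := by
    rw [← pow_succ, show 2 * m + 1 + 1 = 2 * (m + 1) by ring, pow_mul, ← Real.exp_nat_mul]
    congr 2; push_cast; ring
  rw [← exp_neg_pow_div_one_add_sq, ← h]
  push_cast
  rfl

lemma oddPowerSum_inv_self (s : ℝ) :
    oddPowerSum (Real.exp (-(Real.pi * s / 2))) ((Real.exp (-(Real.pi * s / 2)) : ℝ) : ℂ)⁻¹ =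
      ((∑' m : ℕ, (Real.cosh (Real.pi * s * (m : ℝ)))⁻¹ / 2 : ℝ) : ℂ) := by
  rw [oddPowerSum, Complex.ofReal_tsum]
  refine tsum_congr fun m => ?_
  have h : Real.exp (-(Real.pi * s / 2)) ^ (2 * m + 1) * (Real.exp (-(Real.pi * s / 2)))⁻¹ =
      Real.exp (-(Real.pi * s)) ^ m := by
    rw [pow_succ, mul_inv_cancel_right₀ (Real.exp_pos _).ne', pow_mul, ← Real.exp_nat_mul]
    congr 2; push_cast; ring
  rw [← exp_neg_pow_div_one_add_sq, ← h]
  push_cast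
  rfl

/-- The arguments are `q^(m+1)` and `q^m`, so the two sums are half of the bilateral `sech` sum
folded by evenness, without and with the central term `1`. -/
lemma oddPowerSum_values {s : ℝ} (hs : 0 < s) :
    oddPowerSum (Real.exp (-(Real.pi * s / 2))) (Real.exp (-(Real.pi * s / 2)) : ℝ) =
        (((sechSum s - 1) / 4 : ℝ) : ℂ) ∧
      oddPowerSum (Real.exp (-(Real.pi * s / 2))) ((Real.exp (-(Real.pi * s / 2)) : ℝ) : ℂ)⁻¹ =
        (((sechSum s + 1) / 4 : ℝ) : ℂ) := by
  rw [oddPowerSum_self, oddPowerSum_inv_self, Complex.ofReal_inj, Complex.ofReal_inj,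
    tsum_div_const, tsum_div_const]
  have hsum := summable_sechSum hs
  have hn : Summable fun m : ℕ => (Real.cosh (Real.pi * s * (m : ℝ)))⁻¹ := by
    simpa using! hsum.comp_injective Nat.cast_injective
  have h1 := hn.tsum_eq_zero_add
  have hn' := (summable_nat_add_iff 1).2 hn
  have h2 := (HasSum.of_nat_of_neg_add_one (f := fun n : ℤ => (Real.cosh (Real.pi * s * n))⁻¹)
    (by simpa using hn.hasSum) (m' := ∑' m : ℕ, (Real.cosh (Real.pi * s * ((m + 1 : ℕ) : ℝ)))⁻¹)
    (by
      refine hn'.hasSum.congr_fun fun m => ?_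
      rw [← Real.cosh_neg]; congr 2; push_cast; ring)).tsum_eq
  rw [← sechSum] at h2
  simp only [Nat.cast_zero, mul_zero, Real.cosh_zero, inv_one] at h1
  constructor <;> linarith

/-! ### The continuation of `cd₁` and its value at `iK'`. -/

/-- The local parameter `exp (i π u / (2 K))`. -/
noncomputable def ellipticExp (K : ℝ) (u : ℂ) : ℂ :=
  Complex.exp (Complex.I * ((Real.pi : ℂ) / (2 * (K : ℂ))) * u)

/-- The meromorphic continuation of `cd₁` to the plane. -/
noncomputable def cd1Continuation (s k : ℝ) (u : ℂ) : ℂ :=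
  (2 * (Real.pi : ℂ)) / ((ellipticK k : ℂ) * (k : ℂ)) *
    ((ellipticExp (ellipticK k) u ^ 2 *
        oddPowerSum (Real.exp (-(Real.pi * s / 2))) (ellipticExp (ellipticK k) u) +
      (ellipticExp (ellipticK k) u)⁻¹ ^ 2 *
        oddPowerSum (Real.exp (-(Real.pi * s / 2))) (ellipticExp (ellipticK k) u)⁻¹) / 2)

lemma ellipticExp_ne_zero (K : ℝ) (u : ℂ) : ellipticExp K u ≠ 0 := Complex.exp_ne_zero _

lemma analyticAt_ellipticExp (K : ℝ) (u : ℂ) : AnalyticAt ℂ (ellipticExp K) u := by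
  unfold ellipticExp
  fun_prop

lemma ellipticExp_arg (K : ℝ) (u : ℂ) : Complex.I * ((Real.pi : ℂ) / (2 * (K : ℂ))) * u =
    ((Real.pi / (2 * K) : ℝ) : ℂ) * (Complex.I * u) := by
  push_cast; ring

lemma norm_ellipticExp (K : ℝ) (u : ℂ) :
    ‖ellipticExp K u‖ = Real.exp (-(Real.pi / (2 * K) * u.im)) := by
  rw [ellipticExp, ellipticExp_arg, Complex.norm_exp, Complex.re_ofReal_mul]
  simp

lemma re_ellipticExp_pos {K : ℝ} (hK : 0 < K) {u : ℂ} (hu : |u.re| < K) :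
    0 < (ellipticExp K u).re := by
  rw [ellipticExp, ellipticExp_arg, Complex.exp_re, Complex.im_ofReal_mul]
  refine mul_pos (Real.exp_pos _) (Real.cos_pos_of_mem_Ioo ?_)
  have hpi := Real.pi_pos
  have h := abs_lt.1 hu
  rw [Complex.I_mul_im]
  have hK' : Real.pi / (2 * K) * K = Real.pi / 2 := by field_simp
  have hp : 0 < Real.pi / (2 * K) := by positivity
  constructor <;> nlinarith

lemma re_inv_pos {z : ℂ} (hz : 0 < z.re) : 0 < z⁻¹.re := by
  rw [Complex.inv_re]
  refine div_pos hz (Complex.normSq_pos.2 ?_)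
  rintro rfl
  simp at hz

/-- The strip corresponds to the annulus `ρ < |w| < ρ⁻¹`. -/
lemma exp_mul_norm_ellipticExp_lt_one {s K : ℝ} (hK : 0 < K) {u : ℂ} (hu : |u.im| < s * K) :
    Real.exp (-(Real.pi * s / 2)) * ‖ellipticExp K u‖ < 1 ∧
      Real.exp (-(Real.pi * s / 2)) * ‖(ellipticExp K u)⁻¹‖ < 1 := by
  have h := abs_lt.1 hu
  have hpi := Real.pi_pos
  have hp : 0 < Real.pi / (2 * K) := by positivity
  have hK' : Real.pi / (2 * K) * (s * K) = Real.pi * s / 2 := by field_simp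
  rw [norm_inv, norm_ellipticExp, ← Real.exp_neg, neg_neg, ← Real.exp_add, ← Real.exp_add,
    Real.exp_lt_one_iff, Real.exp_lt_one_iff]
  constructor <;> nlinarith

lemma cd1Term_eq {s k : ℝ} (u : ℂ) (n : ℕ) :
    cd1Term (Real.exp (-(Real.pi * s / 2)) ^ 2) k u n =
      ((-1) ^ n * ((Real.exp (-(Real.pi * s / 2)) : ℝ) : ℂ) ^ (2 * n + 1) *
          ellipticExp (ellipticK k) u ^ (2 * n + 3) /
          (1 - (((Real.exp (-(Real.pi * s / 2)) : ℝ) : ℂ) ^ 2) ^ (2 * n + 1)) +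
        (-1) ^ n * ((Real.exp (-(Real.pi * s / 2)) : ℝ) : ℂ) ^ (2 * n + 1) *
          (ellipticExp (ellipticK k) u)⁻¹ ^ (2 * n + 3) /
          (1 - (((Real.exp (-(Real.pi * s / 2)) : ℝ) : ℂ) ^ 2) ^ (2 * n + 1))) / 2 := by
  set ρ := Real.exp (-(Real.pi * s / 2))
  have hρ : 0 < ρ := Real.exp_pos _
  have h1 : (ρ ^ 2) ^ ((n : ℝ) + 1 / 2) = ρ ^ (2 * n + 1) := by
    rw [← Real.rpow_natCast ρ 2, ← Real.rpow_mul hρ.le, ← Real.rpow_natCast]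
    congr 1
    push_cast
    ring
  have h2 : Complex.cos ((2 * (n : ℂ) + 3) * ((Real.pi : ℂ) / (2 * (ellipticK k : ℂ))) * u) =
      (ellipticExp (ellipticK k) u ^ (2 * n + 3) +
        (ellipticExp (ellipticK k) u)⁻¹ ^ (2 * n + 3)) / 2 := by
    rw [ellipticExp, ← Complex.exp_neg, ← Complex.exp_nat_mul, ← Complex.exp_nat_mul, Complex.cos]
    congr 3 <;> push_cast <;> ring
  rw [cd1Term, h1, h2]
  push_cast
  ring

lemma hasSum_cd1Term {s k : ℝ} (hs : 0 < s) (hK : 0 < ellipticK k) {u : ℂ}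
    (hu : |u.im| < s * ellipticK k) :
    HasSum (cd1Term (Real.exp (-(Real.pi * s / 2)) ^ 2) k u)
      ((ellipticExp (ellipticK k) u ^ 2 *
        oddPowerSum (Real.exp (-(Real.pi * s / 2))) (ellipticExp (ellipticK k) u) +
      (ellipticExp (ellipticK k) u)⁻¹ ^ 2 *
        oddPowerSum (Real.exp (-(Real.pi * s / 2))) (ellipticExp (ellipticK k) u)⁻¹) / 2) := by
  have hρ1 : Real.exp (-(Real.pi * s / 2)) < 1 := by
    rw [Real.exp_lt_one_iff, neg_lt_zero]; positivity
  obtain ⟨h1, h2⟩ := exp_mul_norm_ellipticExp_lt_one hK hu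
  exact (((hasSum_oddPowerSum (Real.exp_pos _) hρ1 h1).add
    (hasSum_oddPowerSum (Real.exp_pos _) hρ1 h2)).div_const 2).congr_fun fun n => cd1Term_eq u n

lemma cd1_eq_cd1Continuation {s k : ℝ} (hs : 0 < s) (hK : 0 < ellipticK k) {u : ℂ}
    (hu : |u.im| < s * ellipticK k) :
    cd1 (Real.exp (-(Real.pi * s / 2)) ^ 2) k u = cd1Continuation s k u := by
  rw [cd1, (hasSum_cd1Term hs hK hu).tsum_eq, cd1Continuation]

lemma meromorphicAt_cd1Continuation {s : ℝ} (hs : 0 < s) (k : ℝ) (u : ℂ) :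
    MeromorphicAt (cd1Continuation s k) u := by
  have hρ1 : Real.exp (-(Real.pi * s / 2)) < 1 := by
    rw [Real.exp_lt_one_iff, neg_lt_zero]; positivity
  have hE := analyticAt_ellipticExp (ellipticK k) u
  have hE' := hE.fun_inv (ellipticExp_ne_zero _ _)
  have h1 := (meromorphicAt_oddPowerSum (Real.exp_pos _) hρ1 _).comp_analyticAt hE
  have h2 := (meromorphicAt_oddPowerSum (Real.exp_pos _) hρ1 _).comp_analyticAt hE'
  exact (MeromorphicAt.const _ _).mul ((((hE.meromorphicAt.pow 2).mul h1).add
    ((hE'.meromorphicAt.pow 2).mul h2)).div (MeromorphicAt.const _ _))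

/-- A term is singular only where `x² = -1`. In the horizontal strip `|x| < 1`; in the vertical
strip `Re w > 0`, hence `Re x > 0`, also for `w⁻¹`. -/
lemma analyticAt_cd1Continuation {s k : ℝ} (hs : 0 < s) (hK : 0 < ellipticK k) {u : ℂ}
    (hu : |u.im| < s * ellipticK k ∨ |u.re| < ellipticK k) :
    AnalyticAt ℂ (cd1Continuation s k) u := by
  set ρ := Real.exp (-(Real.pi * s / 2)) with hρ
  have hρ0 : 0 < ρ := Real.exp_pos _
  have hρ1 : ρ < 1 := by
    rw [hρ, Real.exp_lt_one_iff, neg_lt_zero]; positivity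
  have hE := analyticAt_ellipticExp (ellipticK k) u
  have hE' := hE.fun_inv (ellipticExp_ne_zero _ _)
  have hnorm (w : ℂ) (hw : ρ * ‖w‖ < 1) (m : ℕ) : 1 + ((ρ : ℂ) ^ (2 * m + 1) * w) ^ 2 ≠ 0 := by
    refine one_add_sq_ne_zero_of_norm_lt_one (lt_of_le_of_lt ?_ hw)
    rw [norm_mul, norm_pow, Complex.norm_real, Real.norm_of_nonneg hρ0.le]
    gcongr
    exact pow_le_of_le_one hρ0.le hρ1.le (by omega)
  have hre (w : ℂ) (hw : 0 < w.re) (m : ℕ) : 1 + ((ρ : ℂ) ^ (2 * m + 1) * w) ^ 2 ≠ 0 := by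
    refine one_add_sq_ne_zero_of_re_pos ?_
    rw [← Complex.ofReal_pow, Complex.re_ofReal_mul]
    positivity
  obtain ⟨hw, hw'⟩ : (∀ m : ℕ, 1 + ((ρ : ℂ) ^ (2 * m + 1) * ellipticExp (ellipticK k) u) ^ 2 ≠ 0) ∧
      ∀ m : ℕ, 1 + ((ρ : ℂ) ^ (2 * m + 1) * (ellipticExp (ellipticK k) u)⁻¹) ^ 2 ≠ 0 := by
    rcases hu with hu | hu
    · obtain ⟨h1, h2⟩ := exp_mul_norm_ellipticExp_lt_one hK hu
      exact ⟨hnorm _ h1, hnorm _ h2⟩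
    · have h := re_ellipticExp_pos hK hu
      exact ⟨hre _ h, hre _ (re_inv_pos h)⟩
  have h1 := (analyticAt_oddPowerSum hρ0 hρ1 hw).comp hE
  have h2 := (analyticAt_oddPowerSum hρ0 hρ1 hw').comp (f := fun u => (ellipticExp _ u)⁻¹) hE'
  exact analyticAt_const.mul ((((hE.pow 2).mul h1).add ((hE'.pow 2).mul h2)).div
    analyticAt_const two_ne_zero)

lemma cd1Continuation_I_mul {s k : ℝ} (hs : 0 < s) (hk : k ≠ 0) (hK : 0 < ellipticK k)
    (hθ : 2 * ellipticK k = Real.pi * sechSum s) :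
    cd1Continuation s k (Complex.I * ((s * ellipticK k : ℝ) : ℂ)) =
      ((1 / (Real.exp (-(Real.pi * s / 2)) ^ 2 * k) - Real.sinh (Real.pi * s) / k *
        (1 - Real.pi / (2 * ellipticK k)) : ℝ) : ℂ) := by
  have hE : ellipticExp (ellipticK k) (Complex.I * ((s * ellipticK k : ℝ) : ℂ)) =
      ((Real.exp (-(Real.pi * s / 2)) : ℝ) : ℂ) := by
    rw [ellipticExp, ellipticExp_arg, ← mul_assoc Complex.I, Complex.I_mul_I, neg_one_mul,
      ← Complex.ofReal_neg, ← Complex.ofReal_mul, ← Complex.ofReal_exp]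
    congr 2
    field_simp
  obtain ⟨h1, h2⟩ := oddPowerSum_values hs
  have hsinh : Real.sinh (Real.pi * s) =
      ((Real.exp (-(Real.pi * s / 2)) ^ 2)⁻¹ - Real.exp (-(Real.pi * s / 2)) ^ 2) / 2 := by
    rw [Real.sinh_eq, ← Real.exp_nat_mul, ← Real.exp_neg]
    congr 3 <;> push_cast <;> ring
  rw [cd1Continuation, hE, h1, h2, hsinh]
  norm_cast
  have hρ := Real.exp_pos (-(Real.pi * s / 2))
  generalize Real.exp (-(Real.pi * s / 2)) = ρ at hρ
  have hpi := Real.pi_pos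
  have hS : sechSum s = 2 * ellipticK k / Real.pi := by rw [hθ]; field_simp
  rw [hS]
  field_simp
  ring

/-! ### Uniqueness of continuation and the theorem. -/

/-- If a function analytic on a connected set agrees near one point with a meromorphic function,
the two agree at every point of the set at which the second is analytic. -/
lemma AnalyticOnNhd.eq_of_meromorphicOn {F G : ℂ → ℂ} {U : Set ℂ} {a b : ℂ}
    (hF : AnalyticOnNhd ℂ F U) (hG : MeromorphicOn G U) (hU : IsConnected U) (ha : a ∈ U)
    (hb : b ∈ U) (hab : F =ᶠ[𝓝 a] G) (hGb : AnalyticAt ℂ G b) : F b = G b := by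
  -- `U` may contain poles of `G`, so the analytic identity theorem is replaced by propagation of
  -- infinite order of `F - G`.
  have hmer : MeromorphicOn (F - G) U := hF.meromorphicOn.sub hG
  have hatop : meromorphicOrderAt (F - G) a = ⊤ := by
    rw [meromorphicOrderAt_eq_top_iff]
    filter_upwards [hab.filter_mono nhdsWithin_le_nhds] with z hz
    simp [hz]
  have hbtop : meromorphicOrderAt (F - G) b = ⊤ := by
    by_contra h
    exact (hmer.exists_meromorphicOrderAt_ne_top_iff_forall_mem hU).1 ⟨b, hb, h⟩ a ha hatop
  rw [meromorphicOrderAt_eq_top_iff] at hbtop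
  -- Infinite order gives equality only on a punctured neighbourhood; analyticity of both functions
  -- at `b` fills in the point.
  have h : ∃ᶠ z in 𝓝[≠] b, F z = G z :=
    (hbtop.mono fun z hz => sub_eq_zero.1 hz).frequently
  exact EventuallyEq.eq_of_nhds (((hF b hb).frequently_eq_iff_eventually_eq hGb).1 h)

lemma IsSingularModulus.ellipticK'_eq {r k : ℝ} (h : IsSingularModulus r k) :
    ellipticK' k = √r * ellipticK k := by
  rw [← h.2.2, div_mul_cancel₀ _ (ellipticK_pos h.1.le h.2.1).ne']

lemma IsSingularModulus.two_mul_ellipticK {r k : ℝ} (hr : 0 < r) (h : IsSingularModulus r k) :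
    2 * ellipticK k = Real.pi * sechSum √r := by
  have hs := Real.sqrt_pos.2 hr
  rw [h.unique (isSingularModulus_thetaModulus hr), ellipticK_thetaModulus hs, sechSum_eq hs]
  ring

theorem theorem12 (r : ℝ) (hr : 0 < r) :
    (∃! k : ℝ, IsSingularModulus r k) ∧
    ∀ k q : ℝ, IsSingularModulus r k → q = Real.exp (-Real.pi * Real.sqrt r) →
      (∀ u ∈ cd1Strip k, Summable (cd1Term q k u)) ∧
      (∃ (F : ℂ → ℂ) (U : Set ℂ), IsAnalyticContinuation (cd1 q k) (cd1Strip k) F U ∧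
        Complex.I * (ellipticK' k : ℂ) ∈ U) ∧
      ∀ (F : ℂ → ℂ) (U : Set ℂ), IsAnalyticContinuation (cd1 q k) (cd1Strip k) F U →
        Complex.I * (ellipticK' k : ℂ) ∈ U →
        F (Complex.I * (ellipticK' k : ℂ)) =
          ((1 / (q * k) - Real.sinh (Real.pi * Real.sqrt r) / k *
            (1 - Real.pi / (2 * ellipticK k)) : ℝ) : ℂ) := by
  refine ⟨⟨thetaModulus √r, isSingularModulus_thetaModulus hr,
    fun l hl => hl.unique (isSingularModulus_thetaModulus hr)⟩, ?_⟩
  intro k q hk hq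
  have hs : 0 < √r := Real.sqrt_pos.2 hr
  have hK := ellipticK_pos hk.1.le hk.2.1
  have hK' := hk.ellipticK'_eq
  have hsK : 0 < √r * ellipticK k := by positivity
  have hq' : q = Real.exp (-(Real.pi * √r / 2)) ^ 2 := by
    rw [hq, ← Real.exp_nat_mul]
    congr 1
    push_cast
    ring
  have hstrip (u : ℂ) (hu : u ∈ cd1Strip k) : |u.im| < √r * ellipticK k := by
    rw [← hK']; exact hu
  have hI : |(Complex.I * ((√r * ellipticK k : ℝ) : ℂ)).re| < ellipticK k := by
    rw [Complex.I_mul_re, Complex.ofReal_im, neg_zero, abs_zero]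
    exact hK
  have hval := cd1Continuation_I_mul hs hk.1.ne' hK (hk.two_mul_ellipticK hr)
  have heq (u : ℂ) (hu : u ∈ cd1Strip k) : cd1 q k u = cd1Continuation √r k u := by
    rw [hq', cd1_eq_cd1Continuation hs hK (hstrip u hu)]
  have hopen : IsOpen (cd1Strip k) :=
    isOpen_lt (Complex.continuous_im.abs) continuous_const
  have h0 : (0 : ℂ) ∈ cd1Strip k := by
    simp only [cd1Strip, Set.mem_ofPred_eq, Complex.zero_im, abs_zero, hK']
    exact hsK
  refine ⟨fun u hu => ?_, ?_, ?_⟩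
  · rw [hq']
    exact (hasSum_cd1Term hs hK (hstrip u hu)).summable
  -- The domain is a cross of two convex strips meeting at `0`; the vertical arm reaches `iK'`
  -- between the poles.
  · refine ⟨cd1Continuation √r k, cd1Strip k ∪ {u : ℂ | |u.re| < ellipticK k},
      ⟨hopen.union (isOpen_lt Complex.continuous_re.abs continuous_const), ?_,
        Set.subset_union_left, ?_, fun u hu => (heq u hu).symm⟩, Or.inr ?_⟩
    · have hc1 : Convex ℝ (cd1Strip k) := by
        have : cd1Strip k = Complex.imLm ⁻¹' Metric.ball 0 (ellipticK' k) := by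
          ext u; simp [cd1Strip]
        rw [this]
        exact (convex_ball _ _).linear_preimage _
      have hc2 : Convex ℝ {u : ℂ | |u.re| < ellipticK k} := by
        have : {u : ℂ | |u.re| < ellipticK k} = Complex.reLm ⁻¹' Metric.ball 0 (ellipticK k) := by
          ext u; simp
        rw [this]
        exact (convex_ball _ _).linear_preimage _
      have h0' : (0 : ℂ) ∈ {u : ℂ | |u.re| < ellipticK k} := by simpa using hK
      exact IsConnected.union ⟨0, h0, h0'⟩ ⟨⟨0, h0⟩, hc1.isPreconnected⟩
        ⟨⟨0, h0'⟩, hc2.isPreconnected⟩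
    · rintro u (hu | hu)
      · exact analyticAt_cd1Continuation hs hK (Or.inl (hstrip u hu))
      · exact analyticAt_cd1Continuation hs hK (Or.inr hu)
    · rw [hK']
      exact hI
  · rintro F U ⟨-, hconn, hsub, hF, hFeq⟩ hmem
    rw [hK'] at hmem ⊢
    rw [hq', ← hval]
    refine hF.eq_of_meromorphicOn (fun u _ => meromorphicAt_cd1Continuation hs k u) hconn
      (hsub h0) hmem ?_ (analyticAt_cd1Continuation hs hK (Or.inr hI))
    filter_upwards [hopen.mem_nhds h0] with u hu
    rw [hFeq hu, heq u hu]
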